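/- **Setting.** Let $\Omega\subset\mathbb R^3$ be a bounded $C^1$ domain with outward unit normal $n(x)$, let $\mathcal R_x(v)=v-2(v\cdot n(x))n(x)$ for $x\in\partial\Omega$, and put $$\Lambda^{\pm}=\{(x,v)\in\partial\Omega\times\mathbb R^3:\ \pm\, n(x)\cdot v>0\},\qquad \Lambda_0=\{(x,v)\in\partial\Omega\times\mathbb R^3:\ n(x)\cdot v=0\}.$$ For $x\in\overline\Omega$, $v\in\mathbb R^3$ let $t_{min}(x,v)\in[0,\infty]$ be the supremum of the $t\ge 0$ such that $x-sv\in\Omega$ for all $0<s<t$, and let $$\Lambda_0^{(I-)}=\{(x,v)\in\Lambda_0:\ t_{min}(x,v)=0,\ t_{min}(x,-v)\neq0,\ \exists\delta>0\ \forall\tau\in(0,\delta]:\ x-\tau v\notin\overline\Omega\},\qquad \mathfrak C_\Lambda^-=\Lambda^-\cup\Lambda_0^{(I-)},$$ $$D=(\Omega\times\mathbb R^3)\cup\Lambda^+\cup\mathfrak C_\Lambda^- .$$ The backward specular trajectory from $(x,v)$ is given by $T_0=0$, $(X_0,V_0)=(x,v)$ and, as long as $T_{k+1}$ is finite, $$T_{k+1}=T_k+t_{min}(X_k,V_k),\quad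 X_{k+1}=X_k-t_{min}(X_k,V_k)V_k,\quad V_{k+1}=\mathcal R_{X_{k+1}}(V_k).$$ For $T>0$ the continuity set up to time $T$ is $$\mathfrak C_T=\big(\{0\}\times D\big)\cup\big\{(t,x,v)\in(0,T]\times D:\ (X_k,V_{k-1})\in\mathfrak C^-_\Lambda\ \text{ for every } k\ge1 \text{ with } T_k(x,v)\le t\big\}.$$ **Data.** Let $\alpha\in(0,1]$ and let $m:\mathbb R^3\to(0,\infty)$ be continuous. Let $f_0$ be continuous on $D$, let $g$ be continuous on $[0,T]\times\mathfrak C^-_\Lambda$, and let $q_1,q_2$ be continuous on $(0,T)\times\Omega\times\mathbb R^3$ with $\sup_{t,x,v}|q_i(t,x,v)|\,m(v)<\infty$ for $i=1,2$. Assume $$f_0(x,v)=(1-\alpha)f_0(x,\mathcal R_x(v))+g(0,x,v)\qquad\text{for all }(x,v)\in\mathfrak C_\Lambda^- .$$ **Solution.** Let $f$ be a solution of $$[\partial_t+v\cdot\nabla_x+q_1]f=q_2\ \text{ on }(0,T)\times\Omega\times\mathbb R^3,\qquad f(0,\cdot,\cdot)=f_0\ \text{ on } D,$$ $$f(t,x,v)=(1-\alpha)f(t,x,\mathcal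 R_x(v))+g(t,x,v)\quad\text{for all }(t,x,v)\in[0,T]\times\mathfrak C_\Lambda^-,$$ where $\partial_t+v\cdot\nabla_x$ is the derivative along the characteristics $s\mapsto(t+s,x+sv,v)$, and where the values of $f$ at every $(t,x,v)\in[0,T]\times D$ (in particular at $t=0$, at $t=T$ and on the boundary) are the limits of $f$ along the characteristic inside $[0,T]\times\Omega\times\mathbb R^3$, whenever that characteristic reaches the point. **Claim.** No convexity of $\Omega$ being assumed: 1. $f$ is continuous on the set of those $(t,x,v)\in\mathfrak C_T$ for which $t=0$ or there is $N\in\mathbb N$ with $T_N(x,v)\le t<T_{N+1}(x,v)$. 2. If moreover $f$ belongs to $L^\infty_{t,x,v}(m)$, i.e. $\sup_{[0,T]\times\Omega\times\mathbb R^3}|f(t,x,v)|\,m(v)<\infty$, then $f$ is continuous on all of $\mathfrak C_T$. 3. If $\alpha=1$ (pure in-flow), then $f$ is continuous on $\mathfrak C_T\cup\big([0,T]\times\mathfrak C_\Lambda^-\big)$. -/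

import Mathlib

open Set Filter Topology
open scoped ENNReal

/-- Three-dimensional Euclidean space (for positions and for velocities). -/
abbrev E3 : Type := EuclideanSpace ℝ (Fin 3)

namespace Kinetic

/-- `n` is the outward unit normal of `Ω` at `x`: near `x` the set `Ω` is the strict sublevel set
`{φ < 0}` of a `C¹` function `φ` whose gradient at `x` is a positive multiple of the unit
vector `n`. -/
def IsOuterNormal (Ω : Set E3) (x n : E3) : Prop :=
  ‖n‖ = 1 ∧ ∃ (U : Set E3) (φ : E3 → ℝ), IsOpen U ∧ x ∈ U ∧ ContDiffOn ℝ 1 φ U ∧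
    (∀ y ∈ U, y ∈ Ω ↔ φ y < 0) ∧ ∃ c : ℝ, 0 < c ∧ gradient φ x = c • n

/-- Bounded `C¹` domains: open, connected, bounded, and near each boundary point the strict
sublevel set of a `C¹` function with non-vanishing gradient. -/
structure IsBoundedC1Domain (Ω : Set E3) : Prop where
  isOpen : IsOpen Ω
  isConnected : IsConnected Ω
  isBounded : Bornology.IsBounded Ω
  boundary : ∀ x ∈ frontier Ω, ∃ n : E3, IsOuterNormal Ω x n

/-- The outward unit normal `n(x)` at a boundary point `x`. -/
noncomputable def normal (Ω : Set E3) (x : E3) : E3 :=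
  Classical.epsilon (IsOuterNormal Ω x)

/-- Specular reflection `R_x(v) = v - 2 (v · n(x)) n(x)`. -/
noncomputable def reflect (Ω : Set E3) (x v : E3) : E3 :=
  v - (2 * inner ℝ v (normal Ω x)) • normal Ω x

/-- Outgoing part `Λ⁺` of the phase-space boundary. -/
def outgoing (Ω : Set E3) : Set (E3 × E3) :=
  {p | p.1 ∈ frontier Ω ∧ 0 < inner ℝ (normal Ω p.1) p.2}

/-- Ingoing part `Λ⁻` of the phase-space boundary. -/
def ingoing (Ω : Set E3) : Set (E3 × E3) :=
  {p | p.1 ∈ frontier Ω ∧ inner ℝ (normal Ω p.1) p.2 < 0}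

/-- Grazing part `Λ₀` of the phase-space boundary. -/
def grazing (Ω : Set E3) : Set (E3 × E3) :=
  {p | p.1 ∈ frontier Ω ∧ inner ℝ (normal Ω p.1) p.2 = 0}

/-- Backward exit time: the supremum of the `t ≥ 0` such that `x - s v ∈ Ω` for all `0 < s < t`.
It is `∞` for `x ∈ Ω` and `v = 0`. -/
noncomputable def exitTime (Ω : Set E3) (x v : E3) : ℝ≥0∞ :=
  sSup {τ : ℝ≥0∞ | ∃ t : ℝ, 0 ≤ t ∧ τ = ENNReal.ofReal t ∧ ∀ s ∈ Ioo (0 : ℝ) t, x - s • v ∈ Ω}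

/-- Inward inflection grazing boundary `Λ₀^{(I-)}`. -/
def inwardInflection (Ω : Set E3) : Set (E3 × E3) :=
  {p | p ∈ grazing Ω ∧ exitTime Ω p.1 p.2 = 0 ∧ exitTime Ω p.1 (-p.2) ≠ 0 ∧
    ∃ δ : ℝ, 0 < δ ∧ ∀ τ ∈ Ioc (0 : ℝ) δ, p.1 - τ • p.2 ∉ closure Ω}

/-- Boundary continuity set `Λ⁻ ∪ Λ₀^{(I-)}`. -/
def boundaryContinuitySet (Ω : Set E3) : Set (E3 × E3) :=
  ingoing Ω ∪ inwardInflection Ω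

/-- The phase points `(Ω × ℝ³) ∪ Λ⁺ ∪ Λ⁻ ∪ Λ₀^{(I-)}`. -/
def phaseSet (Ω : Set E3) : Set (E3 × E3) :=
  (Ω ×ˢ univ) ∪ (outgoing Ω ∪ boundaryContinuitySet Ω)

/-- Footpoint `X₁(x,v) = x - t_min(x,v) v` of the backward ray (used only when the exit time
is finite). -/
noncomputable def footpoint (Ω : Set E3) (p : E3 × E3) : E3 :=
  p.1 - (exitTime Ω p.1 p.2).toReal • p.2

/-- One step `(x,v) ↦ (X₁, R_{X₁}(v))` of the backward specular trajectory. -/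
noncomputable def bounce (Ω : Set E3) (p : E3 × E3) : E3 × E3 :=
  (footpoint Ω p, reflect Ω (footpoint Ω p) p.2)

/-- `(X_k, V_k)`, with `(X₀, V₀) = (x, v)`. -/
noncomputable def footprint (Ω : Set E3) (p : E3 × E3) (k : ℕ) : E3 × E3 :=
  (bounce Ω)^[k] p

/-- The time `T_k` of the `k`-th backward rebound: `T₀ = 0`, `T_{k+1} = T_k + t_min(X_k, V_k)`. -/
noncomputable def reboundTime (Ω : Set E3) (p : E3 × E3) (k : ℕ) : ℝ≥0∞ :=
  ∑ j ∈ Finset.range k, exitTime Ω (footprint Ω p j).1 (footprint Ω p j).2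

/-- Every rebound of the backward trajectory from `p` within time `t` takes place at a point of
the boundary continuity set: `(X_{k+1}, V_k) ∈ Λ⁻ ∪ Λ₀^{(I-)}` whenever `T_{k+1} ≤ t`. -/
def RegularUpTo (Ω : Set E3) (t : ℝ) (p : E3 × E3) : Prop :=
  ∀ k : ℕ, reboundTime Ω p (k + 1) ≤ ENNReal.ofReal t →
    ((footprint Ω p (k + 1)).1, (footprint Ω p k).2) ∈ boundaryContinuitySet Ω

/-- The backward trajectory from `p` has finitely many rebounds within time `t`, that is
`T_N ≤ t < T_{N+1}` for some natural number `N`. -/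
def FinitelyManyRebounds (Ω : Set E3) (t : ℝ) (p : E3 × E3) : Prop :=
  ∃ N : ℕ, reboundTime Ω p N ≤ ENNReal.ofReal t ∧ ENNReal.ofReal t < reboundTime Ω p (N + 1)

/-- The continuity set, restricted to times in `[0,T]`. -/
def continuitySet (Ω : Set E3) (T : ℝ) : Set (ℝ × E3 × E3) :=
  {p | p.1 ∈ Icc 0 T ∧ p.2 ∈ phaseSet Ω ∧ (p.1 = 0 ∨ RegularUpTo Ω p.1 p.2)}

/-- `f` solves `(∂_t + v·∇_x + q₁) f = q₂` on `(0,T) × Ω × ℝ³` with initial datum `f₀` and the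
mixed boundary condition `f = (1 - α) f ∘ R + g`. The operator `∂_t + v·∇_x` is the derivative
along the straight characteristics, and boundary and initial values are attained as limits along
the characteristics. -/
structure IsSolution (Ω : Set E3) (T α : ℝ) (q₁ q₂ g : ℝ × E3 × E3 → ℝ) (f₀ : E3 × E3 → ℝ)
    (f : ℝ × E3 × E3 → ℝ) : Prop where
  transport : ∀ t ∈ Ioo 0 T, ∀ x ∈ Ω, ∀ v : E3,
    HasDerivAt (fun s : ℝ => f (t + s, x + s • v, v))
      (q₂ (t, x, v) - q₁ (t, x, v) * f (t, x, v)) 0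
  trace : ∀ t ∈ Icc 0 T, ∀ x v : E3, (x, v) ∈ phaseSet Ω →
    ContinuousWithinAt (fun s : ℝ => f (t + s, x + s • v, v))
      {s : ℝ | t + s ∈ Icc 0 T ∧ x + s • v ∈ Ω} 0
  initial : ∀ x v : E3, (x, v) ∈ phaseSet Ω → f (0, x, v) = f₀ (x, v)
  boundary : ∀ t ∈ Icc 0 T, ∀ x v : E3, (x, v) ∈ boundaryContinuitySet Ω →
    f (t, x, v) = (1 - α) * f (t, x, reflect Ω x v) + g (t, x, v)

end Kinetic

/-! ### Geometry of a `C¹` boundary: charts, the unit normal and specular reflection. -/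

namespace Kinetic

variable {Ω : Set E3} {x v n n' : E3}

/-! On a straight backward flight of length min(t, t_min) the equation is a scalar linear ODE, so `f
p` is a damping factor times the value of `f` at the start of the flight, plus a source integral
(`eq_duhamel`). The geometric input is that, relative to `phaseSet Ω`, t_min is continuous at every
point whose footpoint is in Λ⁻ ∪ Λ₀^{(I-)}. It is lower semicontinuous because a ray stays in the
open set Ω until it exits, and upper semicontinuous because just behind such a footpoint the ray is
outside the closure. Hence the start of the flight, the damping and the source depend continuously
on `p`; no convexity enters.

At the start of the flight `f` is either `f₀`, or (1-α) times its value after the rebound plus `g`.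
So the oscillation of `f` at `p` is at most exp(K·flight time)·(1-α) times its oscillation after the
rebound (`oscillation_of_timedBounce`). Finitely many rebounds give oscillation zero by induction.
If `f` is bounded, M rebounds give (1-α)^M·exp(Kt)·2B: reflection preserves the speed, so K and B
never change, and the flight times add up to at most t. Since α > 0 this tends to 0 when the
rebounds never end. For α = 1 the reflected term vanishes and only the first rebound matters.

Claim 1 leaves the case t = 0 at an inflection point, where all T_k vanish and `f` need not be
bounded. Nearby trajectories may rebound any finite number of times, but each rebound adds a
nonnegative multiple of a normal close to n(x). The velocity thus stays in a thin cone with apex at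
the initial one, and conservation of speed together with near tangency keeps it close to v
(`exists_cone_norm_sub_lt`). The data met on the way are close to a = f₀(x,v) and, by compatibility,
g ≈ αa. As (1-α)a + αa = a, the error does not grow with the number of rebounds
(`abs_sub_le_of_near_inflection`). -/

theorem IsOuterNormal.exists_chart (h : IsOuterNormal Ω x n) :
    ∃ (U : Set E3) (φ : E3 → ℝ) (c : ℝ), IsOpen U ∧ x ∈ U ∧ ContDiffOn ℝ 1 φ U ∧
      (∀ y ∈ U, y ∈ Ω ↔ φ y < 0) ∧ 0 < c ∧ gradient φ x = c • n ∧
      HasStrictFDerivAt φ (innerSL ℝ (c • n)) x := by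
  obtain ⟨-, U, φ, hU, hx, hφ, hs, c, hc, hg⟩ := h
  refine ⟨U, φ, c, hU, hx, hφ, hs, hc, hg, ?_⟩
  have h1 : HasStrictFDerivAt φ (fderiv ℝ φ x) x :=
    (hφ.contDiffAt (hU.mem_nhds hx)).hasStrictFDerivAt one_ne_zero
  have h2 : (innerSL ℝ (c • n)) = fderiv ℝ φ x := by
    rw [(h1.differentiableAt.hasGradientAt).hasFDerivAt.fderiv, hg]
    ext y
    simp
  exact h2 ▸ h1

theorem chart_nonpos_of_mem_closure {U : Set E3} {φ : E3 → ℝ} (hU : IsOpen U)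
    (hφ : ContDiffOn ℝ 1 φ U) (hs : ∀ y ∈ U, y ∈ Ω ↔ φ y < 0) {y : E3} (hy : y ∈ U)
    (hyc : y ∈ closure Ω) : φ y ≤ 0 := by
  by_contra! h
  have h1 : ∀ᶠ z in 𝓝 y, 0 < φ z :=
    (hφ.continuousOn.continuousAt (hU.mem_nhds hy)).eventually (lt_mem_nhds h)
  obtain ⟨z, ⟨hz1, hz2⟩, hz3⟩ :=
    mem_closure_iff_nhds.1 hyc _ (Filter.inter_mem h1 (hU.mem_nhds hy))
  exact absurd ((hs z hz2).1 hz3) (not_lt.2 (le_of_lt hz1))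

theorem notMem_of_mem_frontier (hΩ : IsOpen Ω) (hx : x ∈ frontier Ω) : x ∉ Ω := by
  rw [hΩ.frontier_eq] at hx
  exact hx.2

/-- Near an outgoing phase point, backward rays issued from the closure enter the domain, for a
uniform amount of time. -/
theorem IsOuterNormal.eventually_mem (h : IsOuterNormal Ω x n) (hv : 0 < inner ℝ n v) :
    ∃ δ > 0, ∀ᶠ p : E3 × E3 in 𝓝 (x, v), p.1 ∈ closure Ω →
      ∀ r ∈ Ioc (0 : ℝ) δ, p.1 - r • p.2 ∈ Ω := by
  obtain ⟨U, φ, c, hU, hx, hφ, hs, hc, hg, hd⟩ := h.exists_chart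
  -- This ε makes the linearisation error, at most ε·r·‖p.2‖, smaller than the decrease r·c·(n·p.2)
  -- of φ along the ray. Strict differentiability is what lets the base point `p.1` vary too.
  have hε : 0 < c * inner ℝ n v / 2 / (‖v‖ + 1) := by positivity
  set ε := c * inner ℝ n v / 2 / (‖v‖ + 1) with hε_def
  have h1 := hd.isLittleO.def hε
  have ht : Tendsto (fun w : (E3 × E3) × ℝ => (w.1.1 - w.2 • w.1.2, w.1.1))
      (𝓝 ((x, v), 0)) (𝓝 (x, x)) := by
    have : Continuous (fun w : (E3 × E3) × ℝ => (w.1.1 - w.2 • w.1.2, w.1.1)) := by fun_prop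
    simpa using this.tendsto ((x, v), 0)
  have h2 := ht.eventually h1
  have h3 := ht.eventually ((hU.prod hU).mem_nhds (show (x, x) ∈ U ×ˢ U from ⟨hx, hx⟩))
  have h4 : ∀ᶠ w : (E3 × E3) × ℝ in 𝓝 ((x, v), 0), inner ℝ n v / 2 < inner ℝ n w.1.2 := by
    have : Continuous (fun w : (E3 × E3) × ℝ => inner ℝ n w.1.2) := by fun_prop
    exact this.continuousAt.eventually (lt_mem_nhds (by simpa using by linarith))
  have h5 : ∀ᶠ w : (E3 × E3) × ℝ in 𝓝 ((x, v), 0), ‖w.1.2‖ < ‖v‖ + 1 := by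
    have : Continuous (fun w : (E3 × E3) × ℝ => ‖w.1.2‖) := by fun_prop
    exact this.continuousAt.eventually (gt_mem_nhds (by simp))
  have h6 := h2.and (h3.and (h4.and h5))
  rw [nhds_prod_eq, Filter.eventually_prod_iff] at h6
  obtain ⟨pa, hpa, pb, hpb, hab⟩ := h6
  obtain ⟨δ, hδ, hδb⟩ := Metric.eventually_nhds_iff.1 hpb
  refine ⟨δ / 2, by positivity, ?_⟩
  filter_upwards [hpa] with p hp hpc r hr
  have hr0 : dist r 0 < δ := by
    rw [Real.dist_eq, sub_zero, abs_of_pos hr.1]; linarith [hr.2]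
  obtain ⟨k1, ⟨k2, k3⟩, k4, k5⟩ := hab hp (hδb hr0)
  dsimp only at k1 k2 k3 k4 k5
  have hle := chart_nonpos_of_mem_closure hU hφ hs k3 hpc
  rw [hs _ k2]
  have e1 : p.1 - r • p.2 - p.1 = -(r • p.2) := by abel
  rw [e1, norm_neg, norm_smul, Real.norm_eq_abs, Real.norm_eq_abs, abs_of_pos hr.1] at k1
  have e2 : (innerSL ℝ (c • n)) (-(r • p.2)) = -(r * (c * inner ℝ n p.2)) := by
    simp [inner_smul_right]
    ring
  rw [e2] at k1
  have k6 := (abs_le.1 k1).2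
  have e3 : ε * (‖v‖ + 1) = c * inner ℝ n v / 2 := by
    rw [hε_def]; field_simp
  have k7 : ε * ‖p.2‖ < c * inner ℝ n p.2 := by
    calc ε * ‖p.2‖ < ε * (‖v‖ + 1) := by gcongr
      _ = c * (inner ℝ n v / 2) := by rw [e3]; ring
      _ < _ := by gcongr
  have k8 := mul_lt_mul_of_pos_left k7 hr.1
  nlinarith [k6, k8]

/-- The backward ray from an ingoing phase point leaves the closure of the domain. -/
theorem IsOuterNormal.notMem_closure (h : IsOuterNormal Ω x n) (hΩ : IsOpen Ω)
    (hxf : x ∈ frontier Ω) (hv : inner ℝ n v < 0) :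
    ∃ δ > 0, ∀ r ∈ Ioc (0 : ℝ) δ, x - r • v ∉ closure Ω := by
  obtain ⟨U, φ, c, hU, hx, hφ, hs, hc, hg, hd⟩ := h.exists_chart
  have h0 : 0 ≤ φ x := by
    by_contra! h
    exact notMem_of_mem_frontier hΩ hxf ((hs x hx).2 h)
  have hl : HasDerivAt (fun r : ℝ => x - r • v) (-v) 0 := by
    simpa using ((hasDerivAt_id (0 : ℝ)).smul_const v).const_sub x
  have hd' : HasFDerivAt φ (innerSL ℝ (c • n)) (x - (0 : ℝ) • v) := by
    simpa using hd.hasFDerivAt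
  have hD := hd'.comp_hasDerivAt (0 : ℝ) hl
  have hpos : 0 < (innerSL ℝ (c • n)) (-v) := by
    simp
    nlinarith
  have h1 := (hD.tendsto_slope_zero_right).eventually (lt_mem_nhds hpos)
  have h2 : ∀ᶠ r : ℝ in 𝓝[>] 0, x - r • v ∈ U := by
    apply nhdsWithin_le_nhds
    have : Continuous (fun r : ℝ => x - r • v) := by fun_prop
    exact this.continuousAt.eventually (hU.mem_nhds (by simpa using hx))
  obtain ⟨δ, hδ, hδ'⟩ := mem_nhdsGT_iff_exists_Ioc_subset.1 (h1.and h2)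
  refine ⟨δ, hδ, fun r hr hc' => ?_⟩
  obtain ⟨k1, k2⟩ := hδ' hr
  have k3 := chart_nonpos_of_mem_closure hU hφ hs k2 hc'
  simp only [zero_add, Function.comp, zero_smul, sub_zero, smul_eq_mul] at k1
  have k4 : 0 < r⁻¹ := inv_pos.2 hr.1
  nlinarith

/-- If n ≠ n', the velocity n - n' is outgoing for n and ingoing for n', so its backward ray would
both enter Ω and leave the closure. -/
theorem IsOuterNormal.unique (h : IsOuterNormal Ω x n) (h' : IsOuterNormal Ω x n')
    (hΩ : IsOpen Ω) (hx : x ∈ frontier Ω) : n = n' := by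
  by_contra hne
  have hlt : inner ℝ n n' < 1 := by
    have h3 := real_inner_le_norm n n'
    rw [h.1, h'.1, mul_one] at h3
    refine lt_of_le_of_ne h3 fun h4 => hne ?_
    exact (inner_eq_one_iff_of_norm_eq_one h.1 h'.1).1 h4
  have h1 : 0 < inner ℝ n (n - n') := by
    rw [inner_sub_right, real_inner_self_eq_norm_sq, h.1]; linarith
  have h2 : inner ℝ n' (n - n') < 0 := by
    rw [inner_sub_right, real_inner_self_eq_norm_sq, h'.1, real_inner_comm]; linarith
  obtain ⟨δ, hδ, hd⟩ := h.eventually_mem h1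
  obtain ⟨δ', hδ', hd'⟩ := h'.notMem_closure hΩ hx h2
  have hm := hd.self_of_nhds (frontier_subset_closure hx) (min δ δ')
    ⟨lt_min hδ hδ', min_le_left _ _⟩
  exact hd' (min δ δ') ⟨lt_min hδ hδ', min_le_right _ _⟩ (subset_closure hm)

theorem IsBoundedC1Domain.isOuterNormal_normal (hΩ : IsBoundedC1Domain Ω)
    (hx : x ∈ frontier Ω) : IsOuterNormal Ω x (normal Ω x) :=
  Classical.epsilon_spec (hΩ.boundary x hx)

theorem IsBoundedC1Domain.norm_normal (hΩ : IsBoundedC1Domain Ω)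
    (hx : x ∈ frontier Ω) : ‖normal Ω x‖ = 1 :=
  (hΩ.isOuterNormal_normal hx).1

/-- `normal` is chosen pointwise, but uniqueness identifies it near `x` with the normalised gradient
of one single chart. -/
theorem IsBoundedC1Domain.continuousOn_normal (hΩ : IsBoundedC1Domain Ω) :
    ContinuousOn (normal Ω) (frontier Ω) := by
  intro x hx
  have hn := hΩ.isOuterNormal_normal hx
  obtain ⟨U, φ, c, hU, hxU, hφ, hs, hc, hg, hd⟩ := hn.exists_chart
  have hgrad : ContinuousAt (gradient φ) x := by
    have h1 : ContinuousOn (fderiv ℝ φ) U := hφ.continuousOn_fderiv_of_isOpen hU le_rfl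
    exact (InnerProductSpace.toDual ℝ E3).symm.continuous.continuousAt.comp
      (h1.continuousAt (hU.mem_nhds hxU))
  have hne : gradient φ x ≠ 0 := by
    rw [hg]
    refine smul_ne_zero hc.ne' fun h => ?_
    have := hn.1
    simp [h] at this
  have hev : ∀ᶠ y in 𝓝[frontier Ω] x, normal Ω y = ‖gradient φ y‖⁻¹ • gradient φ y := by
    filter_upwards [self_mem_nhdsWithin, nhdsWithin_le_nhds (hU.mem_nhds hxU),
      nhdsWithin_le_nhds (hgrad.eventually_ne hne)] with y hy hyU hyne
    refine (hΩ.isOuterNormal_normal hy).unique ⟨?_, U, φ, hU, hyU, hφ, hs, ‖gradient φ y‖,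
      norm_pos_iff.2 hyne, ?_⟩ hΩ.isOpen hy
    · rw [norm_smul, norm_inv, norm_norm, inv_mul_cancel₀ (norm_ne_zero_iff.2 hyne)]
    · rw [smul_smul, mul_inv_cancel₀ (norm_ne_zero_iff.2 hyne), one_smul]
  have hlim : ContinuousWithinAt (fun y => ‖gradient φ y‖⁻¹ • gradient φ y) (frontier Ω) x :=
    ((hgrad.norm.inv₀ (norm_ne_zero_iff.2 hne)).smul hgrad).continuousWithinAt
  exact hlim.congr_of_eventuallyEq hev (hev.self_of_nhdsWithin hx)

theorem IsBoundedC1Domain.inner_reflect (hΩ : IsBoundedC1Domain Ω) (hx : x ∈ frontier Ω)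
    (v : E3) : inner ℝ (normal Ω x) (reflect Ω x v) = -inner ℝ (normal Ω x) v := by
  rw [reflect, inner_sub_right, inner_smul_right, real_inner_self_eq_norm_sq,
    hΩ.norm_normal hx, real_inner_comm (normal Ω x) v]
  ring

theorem IsBoundedC1Domain.norm_reflect (hΩ : IsBoundedC1Domain Ω) (hx : x ∈ frontier Ω)
    (v : E3) : ‖reflect Ω x v‖ = ‖v‖ := by
  have h : ‖reflect Ω x v‖ ^ 2 = ‖v‖ ^ 2 := by
    rw [reflect, norm_sub_sq_real, norm_smul, hΩ.norm_normal hx, inner_smul_right,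
      Real.norm_eq_abs, mul_one, sq_abs]
    ring
  exact (pow_left_inj₀ (norm_nonneg _) (norm_nonneg _) two_ne_zero).1 h

theorem reflect_of_grazing (h : inner ℝ (normal Ω x) v = 0) : reflect Ω x v = v := by
  rw [reflect, real_inner_comm, h]
  simp

end Kinetic

/-! ### Exit times, footpoints and flights: regularity and recursion. -/

namespace Kinetic

variable {Ω : Set E3} {x v : E3} {T : ℝ}

theorem sub_smul_mem_of_lt_exitTime {s : ℝ} (hs : 0 < s)
    (h : ENNReal.ofReal s < exitTime Ω x v) : x - s • v ∈ Ω := by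
  obtain ⟨_, ⟨t, -, rfl, ht⟩, hlt⟩ := lt_sSup_iff.1 h
  exact ht s ⟨hs, (ENNReal.ofReal_lt_ofReal_iff_of_nonneg hs.le).1 hlt⟩

theorem le_exitTime {t : ℝ} (ht : 0 ≤ t) (h : ∀ s ∈ Ioo (0 : ℝ) t, x - s • v ∈ Ω) :
    ENNReal.ofReal t ≤ exitTime Ω x v :=
  le_sSup ⟨t, ht, rfl, h⟩

theorem exitTime_le {s : ℝ} (hs : 0 < s) (h : x - s • v ∉ Ω) :
    exitTime Ω x v ≤ ENNReal.ofReal s := by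
  by_contra! hlt
  exact h (sub_smul_mem_of_lt_exitTime hs hlt)

theorem mem_phaseSet_iff {p : E3 × E3} :
    p ∈ phaseSet Ω ↔ (p.1 ∈ Ω ∨ p ∈ outgoing Ω) ∨ p ∈ boundaryContinuitySet Ω := by
  simp [phaseSet, or_assoc]

theorem fst_mem_frontier_of_mem_boundaryContinuitySet {p : E3 × E3}
    (h : p ∈ boundaryContinuitySet Ω) : p.1 ∈ frontier Ω := by
  rcases h with h | h
  · exact h.1
  · exact h.1.1

theorem fst_mem_closure_of_mem_phaseSet {p : E3 × E3} (h : p ∈ phaseSet Ω) :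
    p.1 ∈ closure Ω := by
  rcases mem_phaseSet_iff.1 h with (h | h) | h
  · exact subset_closure h
  · exact frontier_subset_closure h.1
  · exact frontier_subset_closure (fst_mem_frontier_of_mem_boundaryContinuitySet h)

theorem mem_phaseSet_of_mem_boundaryContinuitySet {p : E3 × E3}
    (h : p ∈ boundaryContinuitySet Ω) : p ∈ phaseSet Ω :=
  mem_phaseSet_iff.2 (Or.inr h)

namespace IsBoundedC1Domain

variable (hΩ : IsBoundedC1Domain Ω)
include hΩ

theorem exists_notMem_closure {p : E3 × E3} (h : p ∈ boundaryContinuitySet Ω) :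
    ∃ δ > 0, ∀ r ∈ Ioc (0 : ℝ) δ, p.1 - r • p.2 ∉ closure Ω := by
  rcases h with h | h
  · exact (hΩ.isOuterNormal_normal h.1).notMem_closure hΩ.isOpen h.1 h.2
  · exact h.2.2.2

theorem exitTime_eq_zero {p : E3 × E3} (h : p ∈ boundaryContinuitySet Ω) :
    exitTime Ω p.1 p.2 = 0 := by
  obtain ⟨δ, hδ, hd⟩ := hΩ.exists_notMem_closure h
  by_contra hne
  obtain ⟨_, ⟨t, -, rfl, ht⟩, hlt⟩ := lt_sSup_iff.1 (pos_iff_ne_zero.2 hne)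
  have ht0 : 0 < t := ENNReal.ofReal_pos.1 hlt
  have hm : 0 < min δ (t / 2) := lt_min hδ (by positivity)
  exact hd _ ⟨hm, min_le_left _ _⟩ (subset_closure
    (ht _ ⟨hm, lt_of_le_of_lt (min_le_right _ _) (by linarith)⟩))

theorem footpoint_eq {p : E3 × E3} (h : p ∈ boundaryContinuitySet Ω) :
    footpoint Ω p = p.1 := by
  rw [footpoint, hΩ.exitTime_eq_zero h]
  simp

/-- Controls the beginning of nearby rays, where openness of Ω is of no help if the ray starts on
the boundary. -/
theorem exists_eventually_mem {p : E3 × E3} (h : p.1 ∈ Ω ∨ p ∈ outgoing Ω) :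
    ∃ δ > 0, ∀ᶠ p' : E3 × E3 in 𝓝[phaseSet Ω] p,
      ∀ r ∈ Ioc (0 : ℝ) δ, p'.1 - r • p'.2 ∈ Ω := by
  rcases h with h | h
  · have hc : Continuous (fun w : (E3 × E3) × ℝ => w.1.1 - w.2 • w.1.2) := by fun_prop
    have h1 : ∀ᶠ w : (E3 × E3) × ℝ in 𝓝 (p, 0), w.1.1 - w.2 • w.1.2 ∈ Ω :=
      hc.continuousAt.eventually (hΩ.isOpen.mem_nhds (by simpa using h))
    rw [nhds_prod_eq, Filter.eventually_prod_iff] at h1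
    obtain ⟨pa, hpa, pb, hpb, hab⟩ := h1
    obtain ⟨δ, hδ, hδb⟩ := Metric.eventually_nhds_iff.1 hpb
    refine ⟨δ / 2, by positivity, ?_⟩
    filter_upwards [nhdsWithin_le_nhds hpa] with p' hp r hr
    refine hab hp (hδb ?_)
    rw [Real.dist_eq, sub_zero, abs_of_pos hr.1]; linarith [hr.2]
  · obtain ⟨δ, hδ, hd⟩ := (hΩ.isOuterNormal_normal h.1).eventually_mem h.2
    refine ⟨δ, hδ, ?_⟩
    filter_upwards [nhdsWithin_le_nhds hd, self_mem_nhdsWithin] with p' h1 h2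
    exact h1 (fst_mem_closure_of_mem_phaseSet h2)

theorem exitTime_pos {p : E3 × E3} (h : p.1 ∈ Ω ∨ p ∈ outgoing Ω) :
    0 < exitTime Ω p.1 p.2 := by
  obtain ⟨δ, hδ, hd⟩ := hΩ.exists_eventually_mem h
  have hp : p ∈ phaseSet Ω := mem_phaseSet_iff.2 (Or.inl h)
  have h1 := hd.self_of_nhdsWithin hp
  exact lt_of_lt_of_le (ENNReal.ofReal_pos.2 hδ)
    (le_exitTime hδ.le fun s hs => h1 s ⟨hs.1, hs.2.le⟩)

theorem mem_interior_or_outgoing {p : E3 × E3} (hp : p ∈ phaseSet Ω)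
    (h : 0 < exitTime Ω p.1 p.2) : p.1 ∈ Ω ∨ p ∈ outgoing Ω := by
  rcases mem_phaseSet_iff.1 hp with hp | hp
  · exact hp
  · exact absurd (hΩ.exitTime_eq_zero hp) h.ne'

theorem mem_boundaryContinuitySet_of_exitTime_eq_zero {p : E3 × E3} (hp : p ∈ phaseSet Ω)
    (h : exitTime Ω p.1 p.2 = 0) : p ∈ boundaryContinuitySet Ω := by
  rcases mem_phaseSet_iff.1 hp with hp | hp
  · exact absurd h (hΩ.exitTime_pos hp).ne'
  · exact hp

/-- Lower semicontinuity: short times are handled uniformly by `exists_eventually_mem`, the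
remaining compact time interval by openness of Ω. -/
theorem eventually_lt_exitTime {p : E3 × E3} (hp : p ∈ phaseSet Ω) {b : ℝ≥0∞}
    (hb : b < exitTime Ω p.1 p.2) :
    ∀ᶠ p' in 𝓝[phaseSet Ω] p, b < exitTime Ω p'.1 p'.2 := by
  have h := hΩ.mem_interior_or_outgoing hp (lt_of_le_of_lt zero_le hb)
  obtain ⟨δ, hδ, hd⟩ := hΩ.exists_eventually_mem h
  obtain ⟨s, hs0, hbs, hsE⟩ := ENNReal.lt_iff_exists_real_btwn.1 hb
  have hK : ∀ᶠ p' : E3 × E3 in 𝓝 p, ∀ r ∈ Icc δ s, p'.1 - r • p'.2 ∈ Ω := by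
    refine isCompact_Icc.eventually_forall_of_forall_eventually fun r hr => ?_
    have hc : Continuous (fun w : (E3 × E3) × ℝ => w.1.1 - w.2 • w.1.2) := by fun_prop
    refine hc.continuousAt.eventually (hΩ.isOpen.mem_nhds ?_)
    exact sub_smul_mem_of_lt_exitTime (lt_of_lt_of_le hδ hr.1)
      (lt_of_le_of_lt (ENNReal.ofReal_le_ofReal hr.2) hsE)
  filter_upwards [hd, nhdsWithin_le_nhds hK] with p' h1 h2
  refine lt_of_lt_of_le hbs (le_exitTime hs0 fun r hr => ?_)
  rcases le_total r δ with h3 | h3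
  · exact h1 r ⟨hr.1, h3⟩
  · exact h2 r ⟨h3, hr.2.le⟩

/-- Upper semicontinuity: slightly after the footpoint the ray lies in the open complement of the
closure, and so do nearby rays. A ray that merely touches the boundary and re-enters would break
this. -/
theorem eventually_exitTime_lt {p : E3 × E3} (hE : exitTime Ω p.1 p.2 ≠ ∞)
    (hp : (footpoint Ω p, p.2) ∈ boundaryContinuitySet Ω) {b : ℝ≥0∞}
    (hb : exitTime Ω p.1 p.2 < b) : ∀ᶠ p' in 𝓝 p, exitTime Ω p'.1 p'.2 < b := by
  obtain ⟨δ, hδ, hd⟩ := hΩ.exists_notMem_closure hp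
  obtain ⟨e, he0, hEe, heb⟩ := ENNReal.lt_iff_exists_real_btwn.1 hb
  have hlt : (exitTime Ω p.1 p.2).toReal < e := (ENNReal.lt_ofReal_iff_toReal_lt hE).1 hEe
  have hE0 : 0 ≤ (exitTime Ω p.1 p.2).toReal := ENNReal.toReal_nonneg
  set r := min δ (e - (exitTime Ω p.1 p.2).toReal) with hr_def
  have hr : 0 < r := lt_min hδ (by linarith)
  have h1 := hd r ⟨hr, min_le_left _ _⟩
  have h2 : p.1 - ((exitTime Ω p.1 p.2).toReal + r) • p.2 ∈ (closure Ω)ᶜ := by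
    rw [add_smul, ← sub_sub]; exact h1
  have hc : Continuous
      (fun w : E3 × E3 => w.1 - ((exitTime Ω p.1 p.2).toReal + r) • w.2) := by fun_prop
  filter_upwards [hc.continuousAt.eventually (isClosed_closure.isOpen_compl.mem_nhds h2)]
    with p' hp'
  refine lt_of_le_of_lt (exitTime_le (by linarith) fun h => hp' (subset_closure h)) ?_
  refine lt_of_le_of_lt (ENNReal.ofReal_le_ofReal ?_) heb
  have : r ≤ e - (exitTime Ω p.1 p.2).toReal := min_le_right _ _
  linarith

theorem tendsto_exitTime {p : E3 × E3} (hp : p ∈ phaseSet Ω) (hE : exitTime Ω p.1 p.2 ≠ ∞)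
    (hf : (footpoint Ω p, p.2) ∈ boundaryContinuitySet Ω) :
    Tendsto (fun p' : E3 × E3 => exitTime Ω p'.1 p'.2) (𝓝[phaseSet Ω] p)
      (𝓝 (exitTime Ω p.1 p.2)) :=
  tendsto_order.2 ⟨fun _ ha => hΩ.eventually_lt_exitTime hp ha,
    fun _ hb => nhdsWithin_le_nhds (hΩ.eventually_exitTime_lt hE hf hb)⟩

theorem tendsto_footpoint {p : E3 × E3} (hp : p ∈ phaseSet Ω) (hE : exitTime Ω p.1 p.2 ≠ ∞)
    (hf : (footpoint Ω p, p.2) ∈ boundaryContinuitySet Ω) :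
    Tendsto (footpoint Ω) (𝓝[phaseSet Ω] p) (𝓝 (footpoint Ω p)) := by
  have h1 := (ENNReal.tendsto_toReal hE).comp (hΩ.tendsto_exitTime hp hE hf)
  exact (continuousWithinAt_fst).sub (Filter.Tendsto.smul h1 continuousWithinAt_snd)

/-- The normal is continuous only along the frontier, hence the restriction to points whose
footpoint lies there. -/
theorem tendsto_bounce {p : E3 × E3} (hp : p ∈ phaseSet Ω) (hE : exitTime Ω p.1 p.2 ≠ ∞)
    (hf : (footpoint Ω p, p.2) ∈ boundaryContinuitySet Ω) :
    Tendsto (bounce Ω) (𝓝[phaseSet Ω ∩ {p' | footpoint Ω p' ∈ frontier Ω}] p)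
      (𝓝 (bounce Ω p)) := by
  have h1 : Tendsto (footpoint Ω) (𝓝[phaseSet Ω ∩ {p' | footpoint Ω p' ∈ frontier Ω}] p)
      (𝓝 (footpoint Ω p)) :=
    (hΩ.tendsto_footpoint hp hE hf).mono_left (nhdsWithin_mono _ inter_subset_left)
  have h2 : Tendsto (footpoint Ω) (𝓝[phaseSet Ω ∩ {p' | footpoint Ω p' ∈ frontier Ω}] p)
      (𝓝[frontier Ω] (footpoint Ω p)) := by
    refine tendsto_nhdsWithin_iff.2 ⟨h1, ?_⟩
    filter_upwards [self_mem_nhdsWithin] with p' hp' using hp'.2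
  have h3 := (hΩ.continuousOn_normal _
    (fst_mem_frontier_of_mem_boundaryContinuitySet hf)).tendsto.comp h2
  have h4 : Tendsto (fun p' : E3 × E3 => p'.2)
      (𝓝[phaseSet Ω ∩ {p' | footpoint Ω p' ∈ frontier Ω}] p) (𝓝 p.2) :=
    continuousWithinAt_snd
  exact h1.prodMk_nhds
    (h4.sub (((h4.inner h3).const_mul 2).smul h3))

theorem reflect_mem_phaseSet {p : E3 × E3} (h : p ∈ boundaryContinuitySet Ω) :
    (p.1, reflect Ω p.1 p.2) ∈ phaseSet Ω := by
  rcases h with h | h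
  · refine mem_phaseSet_iff.2 (Or.inl (Or.inr ⟨h.1, ?_⟩))
    have h2 := h.2
    rw [hΩ.inner_reflect h.1]
    linarith
  · rw [reflect_of_grazing h.1.2]
    exact mem_phaseSet_of_mem_boundaryContinuitySet (Or.inr h)

theorem bounce_mem_phaseSet {p : E3 × E3}
    (h : (footpoint Ω p, p.2) ∈ boundaryContinuitySet Ω) : bounce Ω p ∈ phaseSet Ω :=
  hΩ.reflect_mem_phaseSet h

end IsBoundedC1Domain

/-! ### The recursive structure of the trajectory -/

theorem footprint_succ (p : E3 × E3) (k : ℕ) :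
    footprint Ω p (k + 1) = footprint Ω (bounce Ω p) k :=
  Function.iterate_succ_apply _ _ _

theorem reboundTime_zero (p : E3 × E3) : reboundTime Ω p 0 = 0 := by simp [reboundTime]

theorem reboundTime_succ (p : E3 × E3) (k : ℕ) :
    reboundTime Ω p (k + 1) = exitTime Ω p.1 p.2 + reboundTime Ω (bounce Ω p) k := by
  rw [reboundTime, Finset.sum_range_succ', add_comm]
  rfl

theorem reboundTime_one (p : E3 × E3) : reboundTime Ω p 1 = exitTime Ω p.1 p.2 := by
  rw [reboundTime_succ, reboundTime_zero, add_zero]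

theorem reboundTime_succ_le_iff {p : E3 × E3} {t : ℝ}
    (h : exitTime Ω p.1 p.2 ≤ ENNReal.ofReal t) (k : ℕ) :
    reboundTime Ω p (k + 1) ≤ ENNReal.ofReal t ↔
      reboundTime Ω (bounce Ω p) k ≤ ENNReal.ofReal (t - (exitTime Ω p.1 p.2).toReal) := by
  have hne : exitTime Ω p.1 p.2 ≠ ∞ := ne_top_of_le_ne_top ENNReal.ofReal_ne_top h
  rw [ENNReal.ofReal_sub _ ENNReal.toReal_nonneg, ENNReal.ofReal_toReal hne, reboundTime_succ]
  conv_rhs => rw [← ENNReal.add_le_add_iff_left hne, add_tsub_cancel_of_le h]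

theorem RegularUpTo.bounce {p : E3 × E3} {t : ℝ} (hp : RegularUpTo Ω t p)
    (h : exitTime Ω p.1 p.2 ≤ ENNReal.ofReal t) :
    RegularUpTo Ω (t - (exitTime Ω p.1 p.2).toReal) (bounce Ω p) := by
  intro k hk
  have := hp (k + 1) ((reboundTime_succ_le_iff h (k + 1)).2 hk)
  rwa [footprint_succ, footprint_succ p k] at this

theorem RegularUpTo.footpoint_mem {p : E3 × E3} {t : ℝ} (hp : RegularUpTo Ω t p)
    (h : exitTime Ω p.1 p.2 ≤ ENNReal.ofReal t) :
    (footpoint Ω p, p.2) ∈ boundaryContinuitySet Ω :=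
  hp 0 (by rwa [zero_add, reboundTime_one])

/-- Rebounds at time 0 come from vanishing exit times, and a phase point with vanishing exit time is
its own footpoint in the boundary continuity set. This makes the clause t = 0 in `continuitySet`
redundant. -/
theorem IsBoundedC1Domain.regularUpTo_zero (hΩ : IsBoundedC1Domain Ω) {p : E3 × E3}
    (hp : p ∈ phaseSet Ω) : RegularUpTo Ω 0 p := by
  intro k
  induction k generalizing p with
  | zero =>
    intro h
    rw [zero_add, reboundTime_one, ENNReal.ofReal_zero] at h
    have h1 := hΩ.mem_boundaryContinuitySet_of_exitTime_eq_zero hp (le_antisymm h zero_le)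
    change (footpoint Ω p, p.2) ∈ _
    rwa [hΩ.footpoint_eq h1]
  | succ k ih =>
    intro h
    rw [reboundTime_succ, ENNReal.ofReal_zero] at h
    have h0 := add_eq_zero.1 (le_antisymm h zero_le)
    have h1 := hΩ.mem_boundaryContinuitySet_of_exitTime_eq_zero hp h0.1
    have h2 : (footpoint Ω p, p.2) ∈ boundaryContinuitySet Ω := by rwa [hΩ.footpoint_eq h1]
    have := ih (hΩ.bounce_mem_phaseSet h2) (by rw [h0.2]; exact zero_le)
    rwa [footprint_succ, footprint_succ p k]

/-- Phase points with time, such that the first rebound within the available time, if there is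
one, takes place at a point of the boundary continuity set. -/
def firstReboundRegular (Ω : Set E3) (T : ℝ) : Set (ℝ × E3 × E3) :=
  {p | p.1 ∈ Icc 0 T ∧ p.2 ∈ phaseSet Ω ∧ (exitTime Ω p.2.1 p.2.2 ≤ ENNReal.ofReal p.1 →
    (footpoint Ω p.2, p.2.2) ∈ boundaryContinuitySet Ω)}

/-- Time spent on the last straight piece of the trajectory since the initial time. -/
noncomputable def flightTime (Ω : Set E3) (p : ℝ × E3 × E3) : ℝ :=
  (min (ENNReal.ofReal p.1) (exitTime Ω p.2.1 p.2.2)).toReal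

theorem IsBoundedC1Domain.mem_continuitySet_iff (hΩ : IsBoundedC1Domain Ω)
    {p : ℝ × E3 × E3} : p ∈ continuitySet Ω T ↔
      p.1 ∈ Icc 0 T ∧ p.2 ∈ phaseSet Ω ∧ RegularUpTo Ω p.1 p.2 := by
  refine and_congr_right fun _ => and_congr_right fun h => ⟨?_, Or.inr⟩
  rintro (h0 | h0)
  · rw [h0]; exact hΩ.regularUpTo_zero h
  · exact h0

theorem IsBoundedC1Domain.continuitySet_subset (hΩ : IsBoundedC1Domain Ω) :
    continuitySet Ω T ⊆ firstReboundRegular Ω T := by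
  intro p hp
  obtain ⟨h1, h2, h3⟩ := hΩ.mem_continuitySet_iff.1 hp
  exact ⟨h1, h2, h3.footpoint_mem⟩

theorem IsBoundedC1Domain.boundary_subset (hΩ : IsBoundedC1Domain Ω) :
    Icc 0 T ×ˢ boundaryContinuitySet Ω ⊆ firstReboundRegular Ω T := by
  rintro p ⟨h1, h2⟩
  refine ⟨h1, mem_phaseSet_of_mem_boundaryContinuitySet h2, fun _ => ?_⟩
  rwa [hΩ.footpoint_eq h2]

theorem flightTime_nonneg (p : ℝ × E3 × E3) : 0 ≤ flightTime Ω p := ENNReal.toReal_nonneg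

theorem flightTime_le {p : ℝ × E3 × E3} (h : 0 ≤ p.1) : flightTime Ω p ≤ p.1 := by
  have := ENNReal.toReal_mono ENNReal.ofReal_ne_top
    (min_le_left (ENNReal.ofReal p.1) (exitTime Ω p.2.1 p.2.2))
  rwa [ENNReal.toReal_ofReal h] at this

theorem ofReal_flightTime (p : ℝ × E3 × E3) :
    ENNReal.ofReal (flightTime Ω p) = min (ENNReal.ofReal p.1) (exitTime Ω p.2.1 p.2.2) :=
  ENNReal.ofReal_toReal (ne_top_of_le_ne_top ENNReal.ofReal_ne_top (min_le_left _ _))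

theorem flightTime_of_le {p : ℝ × E3 × E3}
    (h : exitTime Ω p.2.1 p.2.2 ≤ ENNReal.ofReal p.1) :
    flightTime Ω p = (exitTime Ω p.2.1 p.2.2).toReal := by
  rw [flightTime, min_eq_right h]

theorem flightTime_of_lt {p : ℝ × E3 × E3} (h0 : 0 ≤ p.1)
    (h : ENNReal.ofReal p.1 < exitTime Ω p.2.1 p.2.2) : flightTime Ω p = p.1 := by
  rw [flightTime, min_eq_left h.le, ENNReal.toReal_ofReal h0]

theorem sub_smul_mem_of_lt_flightTime {p : ℝ × E3 × E3} {r : ℝ}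
    (hr : r ∈ Ioo 0 (flightTime Ω p)) : p.2.1 - r • p.2.2 ∈ Ω := by
  refine sub_smul_mem_of_lt_exitTime hr.1 ?_
  calc ENNReal.ofReal r < ENNReal.ofReal (flightTime Ω p) :=
        (ENNReal.ofReal_lt_ofReal_iff_of_nonneg hr.1.le).2 hr.2
    _ ≤ _ := by rw [ofReal_flightTime]; exact min_le_right _ _

/-- The start of the last straight piece of the trajectory. -/
noncomputable def flightStart (Ω : Set E3) (p : ℝ × E3 × E3) : ℝ × E3 × E3 :=
  (p.1 - flightTime Ω p, p.2.1 - flightTime Ω p • p.2.2, p.2.2)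

theorem flightStart_of_le {p : ℝ × E3 × E3}
    (h : exitTime Ω p.2.1 p.2.2 ≤ ENNReal.ofReal p.1) :
    flightStart Ω p =
      (p.1 - (exitTime Ω p.2.1 p.2.2).toReal, footpoint Ω p.2, p.2.2) := by
  rw [flightStart, flightTime_of_le h, footpoint]

theorem flightStart_of_lt {p : ℝ × E3 × E3} (h0 : 0 ≤ p.1)
    (h : ENNReal.ofReal p.1 < exitTime Ω p.2.1 p.2.2) :
    flightStart Ω p = (0, p.2.1 - p.1 • p.2.2, p.2.2) := by
  rw [flightStart, flightTime_of_lt h0 h, sub_self]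

theorem flightStart_mem {p : ℝ × E3 × E3} (hp : p ∈ firstReboundRegular Ω T) :
    (flightStart Ω p).1 ∈ Icc 0 T ∧ (flightStart Ω p).2 ∈ phaseSet Ω := by
  obtain ⟨h1, h2, h3⟩ := hp
  have h4 : (flightStart Ω p).1 ∈ Icc 0 T :=
    ⟨sub_nonneg.2 (flightTime_le h1.1), by
      have := flightTime_nonneg (Ω := Ω) p
      change p.1 - flightTime Ω p ≤ T
      linarith [h1.2]⟩
  refine ⟨h4, ?_⟩
  rcases le_or_gt (exitTime Ω p.2.1 p.2.2) (ENNReal.ofReal p.1) with h | h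
  · rw [flightStart_of_le h]
    exact mem_phaseSet_of_mem_boundaryContinuitySet (h3 h)
  · rw [flightStart_of_lt h1.1 h]
    rcases h1.1.eq_or_lt with h0 | h0
    · simpa [← h0] using h2
    · exact mem_phaseSet_iff.2 (Or.inl (Or.inl (sub_smul_mem_of_lt_exitTime h0 h)))

theorem tendsto_phase_firstReboundRegular (p : ℝ × E3 × E3) :
    Tendsto (fun p' : ℝ × E3 × E3 => p'.2) (𝓝[firstReboundRegular Ω T] p)
      (𝓝[phaseSet Ω] p.2) :=
  tendsto_nhdsWithin_iff.2 ⟨continuousWithinAt_snd,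
    by filter_upwards [self_mem_nhdsWithin] with q hq using hq.2.1⟩

theorem tendsto_ofReal_time (p : ℝ × E3 × E3) (s : Set (ℝ × E3 × E3)) :
    Tendsto (fun p' : ℝ × E3 × E3 => ENNReal.ofReal p'.1) (𝓝[s] p)
      (𝓝 (ENNReal.ofReal p.1)) :=
  (ENNReal.continuous_ofReal.tendsto _).comp continuousWithinAt_fst

theorem IsBoundedC1Domain.eventually_time_lt_exitTime (hΩ : IsBoundedC1Domain Ω)
    {p : ℝ × E3 × E3} (hp : p ∈ firstReboundRegular Ω T)
    (h : ENNReal.ofReal p.1 < exitTime Ω p.2.1 p.2.2) :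
    ∀ᶠ p' in 𝓝[firstReboundRegular Ω T] p,
      ENNReal.ofReal p'.1 < exitTime Ω p'.2.1 p'.2.2 := by
  obtain ⟨b, hb1, hb2⟩ := exists_between h
  filter_upwards [(tendsto_ofReal_time p _).eventually (gt_mem_nhds hb1),
    (tendsto_phase_firstReboundRegular p).eventually
      (hΩ.eventually_lt_exitTime hp.2.1 hb2)] with q k1 k2 using k1.trans k2

/-- When the exit comes after time t, the exit time itself may jump, but the minimum is locally just
the time coordinate. -/
theorem IsBoundedC1Domain.continuousOn_flightTime (hΩ : IsBoundedC1Domain Ω) :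
    ContinuousOn (flightTime Ω) (firstReboundRegular Ω T) := by
  intro p hp
  obtain ⟨h1, h2, h3⟩ := hp
  rcases le_or_gt (exitTime Ω p.2.1 p.2.2) (ENNReal.ofReal p.1) with h | h
  · have hE := (hΩ.tendsto_exitTime h2 (ne_top_of_le_ne_top ENNReal.ofReal_ne_top h)
      (h3 h)).comp (tendsto_phase_firstReboundRegular (T := T) p)
    exact (ENNReal.tendsto_toReal
      (ne_top_of_le_ne_top ENNReal.ofReal_ne_top (min_le_left _ _))).comp ((tendsto_ofReal_time p _).min hE)
  · have hev : ∀ᶠ p' in 𝓝[firstReboundRegular Ω T] p, flightTime Ω p' = p'.1 := by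
      filter_upwards [hΩ.eventually_time_lt_exitTime ⟨h1, h2, h3⟩ h, self_mem_nhdsWithin]
        with q k1 k2 using flightTime_of_lt k2.1.1 k1
    exact ContinuousWithinAt.congr_of_eventuallyEq continuousWithinAt_fst hev
      (hev.self_of_nhdsWithin ⟨h1, h2, h3⟩)

theorem IsBoundedC1Domain.continuousOn_flightStart (hΩ : IsBoundedC1Domain Ω) :
    ContinuousOn (flightStart Ω) (firstReboundRegular Ω T) := by
  have h := hΩ.continuousOn_flightTime (T := T)
  exact (continuousOn_fst.sub h).prodMk
    ((continuousOn_fst.comp continuousOn_snd fun _ _ => mem_univ _).sub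
      (h.smul (continuousOn_snd.comp continuousOn_snd fun _ _ => mem_univ _)) |>.prodMk
      (continuousOn_snd.comp continuousOn_snd fun _ _ => mem_univ _))

end Kinetic

/-! ### The transport equation along a single flight. -/

namespace Kinetic

open MeasureTheory

/-! ### Duhamel's formula for a scalar linear equation -/

section Scalar

variable {F a b : ℝ → ℝ} {σ K K' T : ℝ}

theorem integrable_indicator_Ioo (ha : ContinuousOn a (Ioo 0 σ))
    (hK : ∀ r ∈ Ioo 0 σ, |a r| ≤ K) : Integrable ((Ioo 0 σ).indicator a) := by
  rw [integrable_indicator_iff measurableSet_Ioo]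
  exact Integrable.of_bound (ha.aestronglyMeasurable measurableSet_Ioo) K
    ((ae_restrict_iff' measurableSet_Ioo).2 (ae_of_all _ hK))

theorem abs_indicator_Ioo_le (hK0 : 0 ≤ K) (hK : ∀ r ∈ Ioo 0 σ, |a r| ≤ K) (r : ℝ) :
    |(Ioo 0 σ).indicator a r| ≤ K := by
  by_cases h : r ∈ Ioo 0 σ
  · rw [indicator_of_mem h]; exact hK r h
  · rw [indicator_of_notMem h, abs_zero]; exact hK0

theorem integral_indicator_Ioo_eq (hσ : 0 ≤ σ) (hσT : σ ≤ T) {c : ℝ → ℝ}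
    (hc : ∀ r, r ∉ Ioo 0 σ → c r = 0) :
    ∫ r in (0 : ℝ)..T, c r = ∫ r in (0 : ℝ)..σ, c r := by
  rw [intervalIntegral.integral_of_le hσ, intervalIntegral.integral_of_le (hσ.trans hσT)]
  refine (setIntegral_eq_of_subset_of_forall_sdiff_eq_zero measurableSet_Ioc
    (Ioc_subset_Ioc_right hσT) fun r hr => hc r fun h => hr.2 ⟨h.1, h.2.le⟩)

/-- Here r runs backwards in time, hence the signs: exp(-A)·F has derivative -exp(-A)·b. Indicators
move the dependence on σ from the limits of integration into the integrand, so that dominated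
convergence later works on the fixed interval [0,T]. -/
theorem duhamel (hσ : 0 ≤ σ) (hσT : σ ≤ T) (hF : ContinuousOn F (Icc 0 σ))
    (hd : ∀ r ∈ Ioo 0 σ, HasDerivAt F (a r * F r - b r) r)
    (ha : ContinuousOn a (Ioo 0 σ)) (hb : ContinuousOn b (Ioo 0 σ))
    (haK : ∀ r ∈ Ioo 0 σ, |a r| ≤ K) (hbK : ∀ r ∈ Ioo 0 σ, |b r| ≤ K') :
    F 0 = Real.exp (-∫ s in (0 : ℝ)..T, (Ioo 0 σ).indicator a s) * F σ +
      ∫ r in (0 : ℝ)..T, Real.exp (-∫ s in (0 : ℝ)..r, (Ioo 0 σ).indicator a s) *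
        (Ioo 0 σ).indicator b r := by
  have hai := integrable_indicator_Ioo ha haK
  have hbi := integrable_indicator_Ioo hb hbK
  set A : ℝ → ℝ := fun r => ∫ s in (0 : ℝ)..r, (Ioo 0 σ).indicator a s with hA
  have hAc : Continuous A := intervalIntegral.continuous_primitive
    (fun _ _ => hai.intervalIntegrable) 0
  have hAd : ∀ r ∈ Ioo 0 σ, HasDerivAt A (a r) r := by
    intro r hr
    have he : (Ioo 0 σ).indicator a =ᶠ[𝓝 r] a := by
      filter_upwards [isOpen_Ioo.mem_nhds hr] with s hs using indicator_of_mem hs a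
    have h1 : ContinuousAt ((Ioo 0 σ).indicator a) r :=
      (ha.continuousAt (isOpen_Ioo.mem_nhds hr)).congr he.symm
    have h2 := intervalIntegral.integral_hasDerivAt_right (a := 0) (b := r)
      hai.intervalIntegrable
      hai.aestronglyMeasurable.stronglyMeasurableAtFilter h1
    rwa [indicator_of_mem hr] at h2
  have hG : ContinuousOn (fun r => Real.exp (-A r) * F r) (Icc 0 σ) :=
    (Real.continuous_exp.comp hAc.neg).continuousOn.mul hF
  have hGd : ∀ r ∈ Ioo 0 σ, HasDerivAt (fun r => Real.exp (-A r) * F r)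
      (-(Real.exp (-A r) * (Ioo 0 σ).indicator b r)) r := by
    intro r hr
    rw [indicator_of_mem hr]
    refine (((hAd r hr).neg.exp).mul (hd r hr)).congr_deriv ?_
    rw [Pi.neg_apply]
    ring
  have hint : IntervalIntegrable (fun r => Real.exp (-A r) * (Ioo 0 σ).indicator b r)
      volume 0 σ :=
    hbi.intervalIntegrable.continuousOn_mul (Real.continuous_exp.comp hAc.neg).continuousOn
  have hftc := intervalIntegral.integral_eq_sub_of_hasDerivAt_of_le hσ hG hGd hint.neg
  have hA0 : A 0 = 0 := by simp [hA]
  have hAT : ∫ s in (0 : ℝ)..T, (Ioo 0 σ).indicator a s = A σ :=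
    integral_indicator_Ioo_eq hσ hσT fun r hr => indicator_of_notMem hr a
  have hBT : ∫ r in (0 : ℝ)..T, Real.exp (-A r) * (Ioo 0 σ).indicator b r =
      ∫ r in (0 : ℝ)..σ, Real.exp (-A r) * (Ioo 0 σ).indicator b r :=
    integral_indicator_Ioo_eq hσ hσT fun r hr => by rw [indicator_of_notMem hr, mul_zero]
  rw [hAT, hBT]
  rw [intervalIntegral.integral_neg] at hftc
  simp only [hA0, neg_zero, Real.exp_zero, one_mul] at hftc
  linarith

theorem abs_integral_indicator_le (hσ : 0 ≤ σ) (hK0 : 0 ≤ K)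
    (haK : ∀ r ∈ Ioo 0 σ, |a r| ≤ K) {r : ℝ} (hr : 0 ≤ r) :
    |∫ s in (0 : ℝ)..r, (Ioo 0 σ).indicator a s| ≤ K * σ := by
  have key : ∀ r, 0 ≤ r → r ≤ σ →
      |∫ s in (0 : ℝ)..r, (Ioo 0 σ).indicator a s| ≤ K * σ := by
    intro r hr hrσ
    have h := intervalIntegral.norm_integral_le_of_norm_le_const (a := 0) (b := r)
      (f := (Ioo 0 σ).indicator a) (C := K) (fun s _ => abs_indicator_Ioo_le hK0 haK s)
    rw [sub_zero, abs_of_nonneg hr] at h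
    exact h.trans (mul_le_mul_of_nonneg_left hrσ hK0)
  rcases le_total r σ with h | h
  · exact key r hr h
  · rw [integral_indicator_Ioo_eq hσ h fun r hr => indicator_of_notMem hr a]
    exact key σ hσ le_rfl

theorem abs_le_of_linear_ode (hσ : 0 ≤ σ) (hF : ContinuousOn F (Icc 0 σ))
    (hd : ∀ r ∈ Ioo 0 σ, HasDerivAt F (a r * F r - b r) r)
    (ha : ContinuousOn a (Ioo 0 σ)) (hb : ContinuousOn b (Ioo 0 σ))
    (hK0 : 0 ≤ K) (hK0' : 0 ≤ K')
    (haK : ∀ r ∈ Ioo 0 σ, |a r| ≤ K) (hbK : ∀ r ∈ Ioo 0 σ, |b r| ≤ K') :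
    |F 0| ≤ Real.exp (K * σ) * (|F σ| + K' * σ) := by
  rw [duhamel hσ le_rfl hF hd ha hb haK hbK]
  have hexp : ∀ r, 0 ≤ r → |Real.exp (-∫ s in (0 : ℝ)..r, (Ioo 0 σ).indicator a s)| ≤
      Real.exp (K * σ) := by
    intro r hr
    rw [Real.abs_exp]
    exact Real.exp_le_exp.2 ((neg_le_abs _).trans (abs_integral_indicator_le hσ hK0 haK hr))
  refine (abs_add_le _ _).trans ?_
  rw [mul_add]
  refine add_le_add ?_ ?_
  · rw [abs_mul]
    exact mul_le_mul_of_nonneg_right (hexp σ hσ) (abs_nonneg _)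
  · have h := intervalIntegral.norm_integral_le_of_norm_le_const (a := 0) (b := σ)
      (C := Real.exp (K * σ) * K')
      (f := fun r => Real.exp (-∫ s in (0 : ℝ)..r, (Ioo 0 σ).indicator a s) *
        (Ioo 0 σ).indicator b r) (fun r hr => by
          rw [uIoc_of_le hσ] at hr
          rw [norm_mul]
          exact mul_le_mul (hexp r hr.1.le) (abs_indicator_Ioo_le hK0' hbK r)
            (norm_nonneg _) (Real.exp_pos _).le)
    rw [sub_zero, abs_of_nonneg hσ] at h
    exact h.trans (le_of_eq (by ring))

end Scalar

/-! ### Duhamel's formula along one straight piece of a trajectory -/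

variable {Ω : Set E3} {T : ℝ}

/-- The phase point a time `r` earlier on the straight characteristic. -/
def backShift (p : ℝ × E3 × E3) (r : ℝ) : ℝ × E3 × E3 :=
  (p.1 - r, p.2.1 - r • p.2.2, p.2.2)

/-- A bound on each velocity ball, uniform in time and space. -/
def BoundedOnVelocityBalls (Ω : Set E3) (I : Set ℝ) (q : ℝ × E3 × E3 → ℝ) : Prop :=
  ∀ R : ℝ, ∃ K, 0 ≤ K ∧ ∀ t ∈ I, ∀ x ∈ Ω, ∀ v : E3, ‖v‖ ≤ R → |q (t, x, v)| ≤ K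

/-- A positive continuous weight has a positive minimum on each closed ball. Bounds on balls suffice
because trajectories conserve speed. -/
theorem boundedOnVelocityBalls_of_weight {I : Set ℝ} {q : ℝ × E3 × E3 → ℝ} {m : E3 → ℝ}
    (hm : Continuous m) (hm_pos : ∀ v, 0 < m v)
    (h : ∃ C : ℝ, ∀ t ∈ I, ∀ x ∈ Ω, ∀ v : E3, |q (t, x, v)| * m v ≤ C) :
    BoundedOnVelocityBalls Ω I q := by
  obtain ⟨C, hC⟩ := h
  intro R
  rcases (Metric.closedBall (0 : E3) R).eq_empty_or_nonempty with he | hne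
  · refine ⟨0, le_rfl, fun t _ x _ v hv => ?_⟩
    have : v ∈ Metric.closedBall (0 : E3) R := by simpa using hv
    simp [he] at this
  · obtain ⟨w, -, hw⟩ := (isCompact_closedBall (0 : E3) R).exists_isMinOn hne hm.continuousOn
    refine ⟨|C| / m w, div_nonneg (abs_nonneg _) (hm_pos w).le, fun t ht x hx v hv => ?_⟩
    have h1 : m w ≤ m v := hw (by simpa using hv)
    rw [le_div_iff₀ (hm_pos w)]
    calc |q (t, x, v)| * m w ≤ |q (t, x, v)| * m v := by gcongr
      _ ≤ C := hC t ht x hx v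
      _ ≤ |C| := le_abs_self C

theorem backShift_mem {p : ℝ × E3 × E3} (hp : p.1 ∈ Icc 0 T) {r : ℝ}
    (hr : r ∈ Ioo 0 (flightTime Ω p)) :
    backShift p r ∈ Ioo 0 T ×ˢ (Ω ×ˢ (univ : Set E3)) := by
  have h := flightTime_le (Ω := Ω) hp.1
  exact ⟨⟨sub_pos.2 (hr.2.trans_le h), by
    change p.1 - r < T
    linarith [hp.2, hr.1]⟩, sub_smul_mem_of_lt_flightTime hr, mem_univ _⟩

theorem continuous_backShift : Continuous fun w : (ℝ × E3 × E3) × ℝ => backShift w.1 w.2 := by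
  unfold backShift; fun_prop

/-- Restriction of `q` to the last straight piece of the trajectory. -/
noncomputable def alongFlight (Ω : Set E3) (q : ℝ × E3 × E3 → ℝ) (p : ℝ × E3 × E3) : ℝ → ℝ :=
  (Ioo 0 (flightTime Ω p)).indicator fun r => q (backShift p r)

section AlongFlight

variable {q : ℝ × E3 × E3 → ℝ} {p : ℝ × E3 × E3}

theorem continuousOn_comp_backShift (hq : ContinuousOn q (Ioo 0 T ×ˢ (Ω ×ˢ (univ : Set E3))))
    (hp : p.1 ∈ Icc 0 T) :
    ContinuousOn (fun r => q (backShift p r)) (Ioo 0 (flightTime Ω p)) :=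
  hq.comp (continuous_backShift.comp (Continuous.prodMk_right p)).continuousOn
    fun _ hr => backShift_mem hp hr

theorem abs_comp_backShift_le {K R : ℝ}
    (hK : ∀ t ∈ Ioo 0 T, ∀ x ∈ Ω, ∀ v : E3, ‖v‖ ≤ R → |q (t, x, v)| ≤ K)
    (hp : p.1 ∈ Icc 0 T) (hv : ‖p.2.2‖ ≤ R) :
    ∀ r ∈ Ioo 0 (flightTime Ω p), |q (backShift p r)| ≤ K := by
  intro r hr
  have h := backShift_mem hp hr
  exact hK _ h.1 _ h.2.1 _ hv

theorem integrable_alongFlight (hq : ContinuousOn q (Ioo 0 T ×ˢ (Ω ×ˢ (univ : Set E3))))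
    (hqb : BoundedOnVelocityBalls Ω (Ioo 0 T) q) (hp : p.1 ∈ Icc 0 T) :
    Integrable (alongFlight Ω q p) := by
  obtain ⟨K, -, hK⟩ := hqb ‖p.2.2‖
  exact integrable_indicator_Ioo (continuousOn_comp_backShift hq hp)
    (abs_comp_backShift_le hK hp le_rfl)

/-- The only moving discontinuity is the end of the flight, a single value of r, which is negligible
in the integrals. -/
theorem continuousWithinAt_alongFlight (hΩ : IsBoundedC1Domain Ω)
    (hq : ContinuousOn q (Ioo 0 T ×ˢ (Ω ×ˢ (univ : Set E3))))
    (hp : p ∈ firstReboundRegular Ω T) {r : ℝ} (hr : r ≠ flightTime Ω p) :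
    ContinuousWithinAt (fun p' => alongFlight Ω q p' r) (firstReboundRegular Ω T) p := by
  have hσ := hΩ.continuousOn_flightTime (T := T) p hp
  by_cases h0 : r ≤ 0
  · refine (continuousWithinAt_const (b := (0 : ℝ))).congr (fun p' _ => ?_) ?_ <;>
    exact indicator_of_notMem (fun h => absurd h.1 (not_lt.2 h0)) _
  push Not at h0
  rcases lt_or_gt_of_ne hr with h | h
  · have hev : ∀ᶠ p' in 𝓝[firstReboundRegular Ω T] p,
        alongFlight Ω q p' r = q (backShift p' r) := by
      filter_upwards [hσ.eventually (lt_mem_nhds h)] with p' hp'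
      exact indicator_of_mem (show r ∈ Ioo 0 (flightTime Ω p') from ⟨h0, hp'⟩) _
    refine ContinuousWithinAt.congr_of_eventuallyEq ?_ hev (hev.self_of_nhdsWithin hp)
    have h1 : ContinuousAt q (backShift p r) :=
      hq.continuousAt ((isOpen_Ioo.prod (hΩ.isOpen.prod isOpen_univ)).mem_nhds
        (backShift_mem hp.1 ⟨h0, h⟩))
    exact (ContinuousAt.comp (f := fun p' => backShift p' r) h1
      (continuous_backShift.comp (Continuous.prodMk_left r)).continuousAt).continuousWithinAt
  · have hev : ∀ᶠ p' in 𝓝[firstReboundRegular Ω T] p, alongFlight Ω q p' r = 0 := by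
      filter_upwards [hσ.eventually (gt_mem_nhds h)] with p' hp'
      exact indicator_of_notMem (fun h => absurd h.2 (not_lt.2 hp'.le)) _
    exact continuousWithinAt_const.congr_of_eventuallyEq hev (hev.self_of_nhdsWithin hp)

theorem eventually_velocity_le (p : ℝ × E3 × E3) (s : Set (ℝ × E3 × E3)) :
    ∀ᶠ p' in 𝓝[s] p, ‖p'.2.2‖ ≤ ‖p.2.2‖ + 1 := by
  have hc : Continuous fun p' : ℝ × E3 × E3 => ‖p'.2.2‖ := by fun_prop
  filter_upwards [nhdsWithin_le_nhds (hc.continuousAt.eventually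
    (gt_mem_nhds (lt_add_one ‖p.2.2‖)))] with p' h using h.le

theorem ae_ne (c : ℝ) : ∀ᵐ r : ℝ, r ≠ c := by
  simp [ae_iff, measure_singleton]

theorem continuousWithinAt_integral_alongFlight (hΩ : IsBoundedC1Domain Ω)
    (hq : ContinuousOn q (Ioo 0 T ×ˢ (Ω ×ˢ (univ : Set E3))))
    (hqb : BoundedOnVelocityBalls Ω (Ioo 0 T) q)
    (hp : p ∈ firstReboundRegular Ω T) (r : ℝ) :
    ContinuousWithinAt (fun p' => ∫ s in (0 : ℝ)..r, alongFlight Ω q p' s)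
      (firstReboundRegular Ω T) p := by
  obtain ⟨K, hK0, hK⟩ := hqb (‖p.2.2‖ + 1)
  refine intervalIntegral.continuousWithinAt_of_dominated_interval (bound := fun _ => K)
    ?_ ?_ intervalIntegrable_const ?_
  · filter_upwards [self_mem_nhdsWithin] with p' hp'
    exact (integrable_alongFlight hq hqb hp'.1).aestronglyMeasurable.restrict
  · filter_upwards [self_mem_nhdsWithin, eventually_velocity_le p _] with p' hp' hv
    exact ae_of_all _ fun s _ =>
      abs_indicator_Ioo_le hK0 (abs_comp_backShift_le hK hp'.1 hv) s
  · filter_upwards [ae_ne (flightTime Ω p)] with s hs _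
    exact continuousWithinAt_alongFlight hΩ hq hp hs

/-- The damping factor collected up to time `r` on the last straight piece. -/
noncomputable def damping (Ω : Set E3) (q₁ : ℝ × E3 × E3 → ℝ) (p : ℝ × E3 × E3) (r : ℝ) : ℝ :=
  Real.exp (-∫ s in (0 : ℝ)..r, alongFlight Ω q₁ p s)

/-- The contribution of the source `q₂` collected on the last straight piece. -/
noncomputable def sourceTerm (Ω : Set E3) (T : ℝ) (q₁ q₂ : ℝ × E3 × E3 → ℝ)
    (p : ℝ × E3 × E3) : ℝ :=
  ∫ r in (0 : ℝ)..T, damping Ω q₁ p r * alongFlight Ω q₂ p r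

variable {q₁ q₂ : ℝ × E3 × E3 → ℝ}

theorem continuousOn_damping (hΩ : IsBoundedC1Domain Ω)
    (hq : ContinuousOn q₁ (Ioo 0 T ×ˢ (Ω ×ˢ (univ : Set E3))))
    (hqb : BoundedOnVelocityBalls Ω (Ioo 0 T) q₁) (r : ℝ) :
    ContinuousOn (fun p => damping Ω q₁ p r) (firstReboundRegular Ω T) := fun _ hp =>
  Real.continuous_exp.continuousAt.comp_continuousWithinAt
    (continuousWithinAt_integral_alongFlight hΩ hq hqb hp r).neg

theorem damping_le {K R : ℝ} (hK0 : 0 ≤ K)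
    (hK : ∀ t ∈ Ioo 0 T, ∀ x ∈ Ω, ∀ v : E3, ‖v‖ ≤ R → |q₁ (t, x, v)| ≤ K)
    (hp : p.1 ∈ Icc 0 T) (hv : ‖p.2.2‖ ≤ R) {r : ℝ} (hr : 0 ≤ r) :
    damping Ω q₁ p r ≤ Real.exp (K * flightTime Ω p) :=
  Real.exp_le_exp.2 ((neg_le_abs _).trans (abs_integral_indicator_le (flightTime_nonneg p) hK0
    (abs_comp_backShift_le hK hp hv) hr))

theorem continuous_damping (hq : ContinuousOn q₁ (Ioo 0 T ×ˢ (Ω ×ˢ (univ : Set E3))))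
    (hqb : BoundedOnVelocityBalls Ω (Ioo 0 T) q₁) (hp : p.1 ∈ Icc 0 T) :
    Continuous (damping Ω q₁ p) :=
  Real.continuous_exp.comp (intervalIntegral.continuous_primitive
    (fun _ _ => (integrable_alongFlight hq hqb hp).intervalIntegrable) 0).neg

theorem continuousOn_sourceTerm (hΩ : IsBoundedC1Domain Ω)
    (hq₁ : ContinuousOn q₁ (Ioo 0 T ×ˢ (Ω ×ˢ (univ : Set E3))))
    (hqb₁ : BoundedOnVelocityBalls Ω (Ioo 0 T) q₁)
    (hq₂ : ContinuousOn q₂ (Ioo 0 T ×ˢ (Ω ×ˢ (univ : Set E3))))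
    (hqb₂ : BoundedOnVelocityBalls Ω (Ioo 0 T) q₂) :
    ContinuousOn (sourceTerm Ω T q₁ q₂) (firstReboundRegular Ω T) := by
  intro p hp
  have hT : 0 ≤ T := hp.1.1.trans hp.1.2
  obtain ⟨K, hK0, hK⟩ := hqb₁ (‖p.2.2‖ + 1)
  obtain ⟨K', hK0', hK'⟩ := hqb₂ (‖p.2.2‖ + 1)
  refine intervalIntegral.continuousWithinAt_of_dominated_interval
    (bound := fun _ => Real.exp (K * T) * K') ?_ ?_ intervalIntegrable_const ?_
  · filter_upwards [self_mem_nhdsWithin] with p' hp'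
    exact ((continuous_damping hq₁ hqb₁ hp'.1).aestronglyMeasurable.mul
      (integrable_alongFlight hq₂ hqb₂ hp'.1).aestronglyMeasurable).restrict
  · filter_upwards [self_mem_nhdsWithin, eventually_velocity_le p _] with p' hp' hv
    refine ae_of_all _ fun s hs => ?_
    rw [uIoc_of_le hT] at hs
    rw [norm_mul]
    refine mul_le_mul ?_ (abs_indicator_Ioo_le hK0' (abs_comp_backShift_le hK' hp'.1 hv) s)
      (norm_nonneg _) (Real.exp_pos _).le
    rw [Real.norm_eq_abs, damping, Real.abs_exp]
    refine (damping_le hK0 hK hp'.1 hv hs.1.le).trans (Real.exp_le_exp.2 ?_)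
    exact mul_le_mul_of_nonneg_left ((flightTime_le hp'.1.1).trans hp'.1.2) hK0
  · filter_upwards [ae_ne (flightTime Ω p)] with s hs _
    exact (continuousOn_damping hΩ hq₁ hqb₁ s p hp).mul
      (continuousWithinAt_alongFlight hΩ hq₂ hp hs)

end AlongFlight

section Solution

variable {α : ℝ} {q₁ q₂ g f : ℝ × E3 × E3 → ℝ} {f₀ : E3 × E3 → ℝ} {p : ℝ × E3 × E3}

namespace IsSolution

theorem hasDerivAt_backShift (hf : IsSolution Ω T α q₁ q₂ g f₀ f) (hp : p.1 ∈ Icc 0 T) :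
    ∀ r ∈ Ioo 0 (flightTime Ω p), HasDerivAt (fun r => f (backShift p r))
      (q₁ (backShift p r) * f (backShift p r) - q₂ (backShift p r)) r := by
  intro r hr
  have h := backShift_mem hp hr
  have h1 := hf.transport _ h.1 _ h.2.1 (backShift p r).2.2
  have h2 : HasDerivAt (fun s : ℝ => r - s) (-1) r := by
    simpa using (hasDerivAt_id r).const_sub r
  have h3 := HasDerivAt.comp_of_eq r h1 h2 (sub_self r).symm
  refine (h3.congr_of_eventuallyEq (Eventually.of_forall fun s => ?_)).congr_deriv (by ring!)
  change f (p.1 - s, p.2.1 - s • p.2.2, p.2.2) =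
    f (p.1 - r + (r - s), p.2.1 - r • p.2.2 + (r - s) • p.2.2, p.2.2)
  rw [show p.1 - r + (r - s) = p.1 - s by ring,
    show p.2.1 - r • p.2.2 + (r - s) • p.2.2 = p.2.1 - s • p.2.2 by module]

/-- Inside the flight this is differentiability; at the two ends it is the trace condition, at `p`
and at `flightStart Ω p` respectively. -/
theorem continuousOn_backShift (hf : IsSolution Ω T α q₁ q₂ g f₀ f)
    (hp : p ∈ firstReboundRegular Ω T) :
    ContinuousOn (fun r => f (backShift p r)) (Icc 0 (flightTime Ω p)) := by
  have hst := flightStart_mem hp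
  intro r hr
  rcases hr.1.eq_or_lt with h0 | h0
  · subst h0
    rcases hr.2.eq_or_lt with h1 | h1
    · rw [← h1, Icc_self]; exact continuousWithinAt_singleton
    · rw [continuousWithinAt_Icc_iff_Ici h1, ← continuousWithinAt_Ioi_iff_Ici,
        ← continuousWithinAt_Ioo_iff_Ioi h1]
      have h2 := hf.trace p.1 hp.1 p.2.1 p.2.2 hp.2.1
      have h3 := ContinuousWithinAt.comp_of_eq (f := fun r : ℝ => -r)
        (s := Ioo 0 (flightTime Ω p)) h2 continuousWithinAt_id.neg (fun r hr => by
          have h4 := backShift_mem hp.1 hr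
          refine ⟨?_, ?_⟩
          · rw [← sub_eq_add_neg]; exact Ioo_subset_Icc_self h4.1
          · rw [neg_smul, ← sub_eq_add_neg]; exact h4.2.1) neg_zero
      refine h3.congr (fun s _ => ?_) ?_ <;>
      simp [backShift, Function.comp, sub_eq_add_neg]
  rcases hr.2.eq_or_lt with h1 | h1
  · rw [h1, continuousWithinAt_Icc_iff_Iic (h1 ▸ h0), ← continuousWithinAt_Iio_iff_Iic,
      ← continuousWithinAt_Ioo_iff_Iio (h1 ▸ h0)]
    have h2 := hf.trace (p.1 - flightTime Ω p) hst.1 (p.2.1 - flightTime Ω p • p.2.2) p.2.2 hst.2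
    have e : ∀ s : ℝ, (p.1 - flightTime Ω p + (flightTime Ω p - s),
        p.2.1 - flightTime Ω p • p.2.2 + (flightTime Ω p - s) • p.2.2, p.2.2) =
          backShift p s := by
      intro s
      rw [backShift, show p.1 - flightTime Ω p + (flightTime Ω p - s) = p.1 - s by ring,
        show p.2.1 - flightTime Ω p • p.2.2 + (flightTime Ω p - s) • p.2.2 =
          p.2.1 - s • p.2.2 by module]
    have h3 := ContinuousWithinAt.comp_of_eq (f := fun r : ℝ => flightTime Ω p - r)
      (s := Ioo 0 (flightTime Ω p)) h2 (continuousWithinAt_const.sub continuousWithinAt_id)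
      (fun r hr => by
          have h4 := backShift_mem hp.1 hr
          rw [← e r] at h4
          exact ⟨Ioo_subset_Icc_self h4.1, h4.2.1⟩) (sub_self _)
    refine h3.congr (fun s _ => ?_) ?_ <;>
    · simp only [Function.comp]
      rw [e]
  · exact (hf.hasDerivAt_backShift hp.1 r ⟨h0, h1⟩).continuousAt.continuousWithinAt

theorem eq_duhamel (hf : IsSolution Ω T α q₁ q₂ g f₀ f)
    (hq₁ : ContinuousOn q₁ (Ioo 0 T ×ˢ (Ω ×ˢ (univ : Set E3))))
    (hqb₁ : BoundedOnVelocityBalls Ω (Ioo 0 T) q₁)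
    (hq₂ : ContinuousOn q₂ (Ioo 0 T ×ˢ (Ω ×ˢ (univ : Set E3))))
    (hqb₂ : BoundedOnVelocityBalls Ω (Ioo 0 T) q₂) (hp : p ∈ firstReboundRegular Ω T) :
    f p = damping Ω q₁ p T * f (flightStart Ω p) + sourceTerm Ω T q₁ q₂ p := by
  obtain ⟨K, -, hK⟩ := hqb₁ ‖p.2.2‖
  obtain ⟨K', -, hK'⟩ := hqb₂ ‖p.2.2‖
  have h := duhamel (flightTime_nonneg p) ((flightTime_le hp.1.1).trans hp.1.2)
    (hf.continuousOn_backShift hp) (hf.hasDerivAt_backShift hp.1)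
    (continuousOn_comp_backShift hq₁ hp.1) (continuousOn_comp_backShift hq₂ hp.1)
    (abs_comp_backShift_le hK hp.1 le_rfl) (abs_comp_backShift_le hK' hp.1 le_rfl)
  have h0 : backShift p 0 = p := by simp [backShift]
  rw [h0] at h
  exact h

/-- The difference f - c solves the same equation with source q₂ - c·q₁. -/
theorem abs_sub_le (hf : IsSolution Ω T α q₁ q₂ g f₀ f)
    (hq₁ : ContinuousOn q₁ (Ioo 0 T ×ˢ (Ω ×ˢ (univ : Set E3))))
    (hq₂ : ContinuousOn q₂ (Ioo 0 T ×ˢ (Ω ×ˢ (univ : Set E3)))) {K K' R c : ℝ} (hK0 : 0 ≤ K)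
    (hK0' : 0 ≤ K') (hK : ∀ t ∈ Ioo 0 T, ∀ x ∈ Ω, ∀ v : E3, ‖v‖ ≤ R → |q₁ (t, x, v)| ≤ K)
    (hK' : ∀ t ∈ Ioo 0 T, ∀ x ∈ Ω, ∀ v : E3, ‖v‖ ≤ R → |q₂ (t, x, v)| ≤ K')
    (hp : p ∈ firstReboundRegular Ω T) (hv : ‖p.2.2‖ ≤ R) :
    |f p - c| ≤ Real.exp (K * flightTime Ω p) *
      (|f (flightStart Ω p) - c| + (K' + K * |c|) * flightTime Ω p) := by
  have hF : ContinuousOn (fun r => f (backShift p r) - c) (Icc 0 (flightTime Ω p)) :=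
    (hf.continuousOn_backShift hp).sub continuousOn_const
  have hq := continuousOn_comp_backShift hq₁ hp.1
  have h := abs_le_of_linear_ode (F := fun r => f (backShift p r) - c)
    (a := fun r => q₁ (backShift p r))
    (b := fun r => q₂ (backShift p r) - q₁ (backShift p r) * c)
    (flightTime_nonneg p) hF (fun r hr => by
      refine ((hf.hasDerivAt_backShift hp.1 r hr).sub_const c).congr_deriv ?_
      ring) hq ((continuousOn_comp_backShift hq₂ hp.1).sub (hq.mul continuousOn_const))
    hK0 (by positivity : 0 ≤ K' + K * |c|) (abs_comp_backShift_le hK hp.1 hv) (fun r hr => by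
      refine (abs_sub _ _).trans (add_le_add (abs_comp_backShift_le hK' hp.1 hv r hr) ?_)
      rw [abs_mul]
      exact mul_le_mul_of_nonneg_right (abs_comp_backShift_le hK hp.1 hv r hr) (abs_nonneg _))
  have h0 : backShift p 0 = p := by simp [backShift]
  rw [h0] at h
  exact h

end IsSolution

end Solution

end Kinetic

/-! ### Propagation of the oscillation through rebounds. -/

namespace Kinetic

/-- The oscillation of `f` at `p` along `s` is at most `η`. -/
def OscillationLE (f : ℝ × E3 × E3 → ℝ) (s : Set (ℝ × E3 × E3)) (p : ℝ × E3 × E3) (η : ℝ) :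
    Prop :=
  ∀ δ > 0, ∀ᶠ p' in 𝓝[s] p, |f p' - f p| ≤ η + δ

theorem OscillationLE.continuousWithinAt {f : ℝ × E3 × E3 → ℝ} {s : Set (ℝ × E3 × E3)}
    {p : ℝ × E3 × E3} (h : OscillationLE f s p 0) : ContinuousWithinAt f s p := by
  refine Metric.tendsto_nhds.2 fun ε hε => ?_
  filter_upwards [h (ε / 2) (by positivity)] with p' hp'
  rw [Real.dist_eq]
  linarith

/-- A solution with continuous data, and coefficients bounded on velocity balls. -/
structure IsSolutionWithContinuousData (Ω : Set E3) (T α : ℝ) (q₁ q₂ g : ℝ × E3 × E3 → ℝ)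
    (f₀ : E3 × E3 → ℝ) (f : ℝ × E3 × E3 → ℝ) : Prop where
  domain : IsBoundedC1Domain Ω
  accommodation : α ∈ Ioc (0 : ℝ) 1
  continuousOn_initial : ContinuousOn f₀ (phaseSet Ω)
  continuousOn_boundary : ContinuousOn g (Icc 0 T ×ˢ boundaryContinuitySet Ω)
  continuousOn_fst : ContinuousOn q₁ (Ioo 0 T ×ˢ (Ω ×ˢ (univ : Set E3)))
  continuousOn_snd : ContinuousOn q₂ (Ioo 0 T ×ˢ (Ω ×ˢ (univ : Set E3)))
  bounded_fst : BoundedOnVelocityBalls Ω (Ioo 0 T) q₁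
  bounded_snd : BoundedOnVelocityBalls Ω (Ioo 0 T) q₂
  compat : ∀ x v : E3, (x, v) ∈ boundaryContinuitySet Ω →
    f₀ (x, v) = (1 - α) * f₀ (x, reflect Ω x v) + g (0, x, v)
  sol : IsSolution Ω T α q₁ q₂ g f₀ f

/-- The first rebound, as a map of phase points with time. -/
noncomputable def timedBounce (Ω : Set E3) (p : ℝ × E3 × E3) : ℝ × E3 × E3 :=
  (p.1 - (exitTime Ω p.2.1 p.2.2).toReal, bounce Ω p.2)

variable {Ω : Set E3} {T α : ℝ} {q₁ q₂ g f : ℝ × E3 × E3 → ℝ} {f₀ : E3 × E3 → ℝ}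
  {p : ℝ × E3 × E3}

theorem IsBoundedC1Domain.timedBounce_mem (hΩ : IsBoundedC1Domain Ω)
    (hp : p ∈ continuitySet Ω T) (h : exitTime Ω p.2.1 p.2.2 ≤ ENNReal.ofReal p.1) :
    timedBounce Ω p ∈ continuitySet Ω T := by
  obtain ⟨h1, h2, h3⟩ := hΩ.mem_continuitySet_iff.1 hp
  have h4 := (flightStart_mem (hΩ.continuitySet_subset hp)).1
  rw [flightStart_of_le h] at h4
  exact hΩ.mem_continuitySet_iff.2
    ⟨h4, hΩ.bounce_mem_phaseSet (h3.footpoint_mem h), h3.bounce h⟩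

theorem IsBoundedC1Domain.tendsto_timedBounce (hΩ : IsBoundedC1Domain Ω)
    (hp : p ∈ continuitySet Ω T) (h : exitTime Ω p.2.1 p.2.2 ≤ ENNReal.ofReal p.1) :
    Tendsto (timedBounce Ω)
      (𝓝[continuitySet Ω T ∩ {p' | exitTime Ω p'.2.1 p'.2.2 ≤ ENNReal.ofReal p'.1}] p)
      (𝓝[continuitySet Ω T] (timedBounce Ω p)) := by
  have hE : exitTime Ω p.2.1 p.2.2 ≠ ∞ := ne_top_of_le_ne_top ENNReal.ofReal_ne_top h
  have hp1 := hΩ.continuitySet_subset hp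
  have h1 : Tendsto (fun p' : ℝ × E3 × E3 => p'.2)
      (𝓝[continuitySet Ω T ∩ {p' | exitTime Ω p'.2.1 p'.2.2 ≤ ENNReal.ofReal p'.1}] p)
      (𝓝[phaseSet Ω ∩ {p' | footpoint Ω p' ∈ frontier Ω}] p.2) := by
    refine tendsto_nhdsWithin_iff.2 ⟨continuousWithinAt_snd, ?_⟩
    filter_upwards [self_mem_nhdsWithin] with p' hp'
    have h2 := hΩ.continuitySet_subset hp'.1
    exact ⟨h2.2.1, fst_mem_frontier_of_mem_boundaryContinuitySet (h2.2.2 hp'.2)⟩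
  refine tendsto_nhdsWithin_iff.2 ⟨?_, ?_⟩
  · refine Tendsto.prodMk_nhds ?_ ((hΩ.tendsto_bounce hp1.2.1 hE (hp1.2.2 h)).comp h1)
    exact Tendsto.sub continuousWithinAt_fst ((ENNReal.tendsto_toReal hE).comp
      ((hΩ.tendsto_exitTime hp1.2.1 hE (hp1.2.2 h)).comp
        (h1.mono_right (nhdsWithin_mono _ inter_subset_left))))
  · filter_upwards [self_mem_nhdsWithin] with p' hp'
    exact hΩ.timedBounce_mem hp'.1 hp'.2

namespace IsSolutionWithContinuousData

variable (H : IsSolutionWithContinuousData Ω T α q₁ q₂ g f₀ f)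
include H

theorem oscillation_transport (hp : p ∈ firstReboundRegular Ω T)
    {l : Filter (ℝ × E3 × E3)} (hl : l ≤ 𝓝[firstReboundRegular Ω T] p) {K η : ℝ}
    (hη : 0 ≤ η) (hK0 : 0 ≤ K)
    (hK : ∀ t ∈ Ioo 0 T, ∀ x ∈ Ω, ∀ v : E3, ‖v‖ ≤ ‖p.2.2‖ → |q₁ (t, x, v)| ≤ K)
    (h : ∀ δ > 0, ∀ᶠ p' in l, |f (flightStart Ω p') - f (flightStart Ω p)| ≤ η + δ) :
    ∀ δ > 0, ∀ᶠ p' in l, |f p' - f p| ≤ Real.exp (K * flightTime Ω p) * η + δ := by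
  intro δ hδ
  have hw := (continuousOn_damping H.domain H.continuousOn_fst H.bounded_fst T p hp).mono_left hl
  have hk := (continuousOn_sourceTerm H.domain H.continuousOn_fst H.bounded_fst
    H.continuousOn_snd H.bounded_snd p hp).mono_left hl
  have hw0 : 0 < damping Ω q₁ p T := Real.exp_pos _
  have hwle := damping_le hK0 hK hp.1 le_rfl (hp.1.1.trans hp.1.2)
  -- Chosen so that the damping turns the slack δ' into δ / 2.
  set δ' := δ / 2 / damping Ω q₁ p T with hδ'
  have hδ'0 : 0 < δ' := by positivity
  have hu : Tendsto (fun p' => damping Ω q₁ p' T * (η + δ') +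
      |damping Ω q₁ p' T - damping Ω q₁ p T| * |f (flightStart Ω p)| +
      |sourceTerm Ω T q₁ q₂ p' - sourceTerm Ω T q₁ q₂ p|) l
      (𝓝 (damping Ω q₁ p T * (η + δ') +
      |damping Ω q₁ p T - damping Ω q₁ p T| * |f (flightStart Ω p)| +
      |sourceTerm Ω T q₁ q₂ p - sourceTerm Ω T q₁ q₂ p|)) :=
    ((hw.mul_const _).add ((hw.sub_const _).abs.mul_const _)).add (hk.sub_const _).abs
  have hlt : damping Ω q₁ p T * (η + δ') +
      |damping Ω q₁ p T - damping Ω q₁ p T| * |f (flightStart Ω p)| +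
      |sourceTerm Ω T q₁ q₂ p - sourceTerm Ω T q₁ q₂ p| <
      Real.exp (K * flightTime Ω p) * η + δ := by
    have e1 : damping Ω q₁ p T * δ' = δ / 2 := by rw [hδ']; field_simp
    have e2 := mul_le_mul_of_nonneg_right hwle hη
    simp only [sub_self, abs_zero, zero_mul, add_zero]
    rw [mul_add]
    linarith
  filter_upwards [hu.eventually (gt_mem_nhds hlt), h δ' hδ'0, hl self_mem_nhdsWithin]
    with p' h1 h2 h3
  refine le_trans ?_ h1.le
  rw [H.sol.eq_duhamel H.continuousOn_fst H.bounded_fst H.continuousOn_snd H.bounded_snd h3,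
    H.sol.eq_duhamel H.continuousOn_fst H.bounded_fst H.continuousOn_snd H.bounded_snd hp]
  have hw' : 0 < damping Ω q₁ p' T := Real.exp_pos _
  have e3 : damping Ω q₁ p' T * f (flightStart Ω p') + sourceTerm Ω T q₁ q₂ p' -
      (damping Ω q₁ p T * f (flightStart Ω p) + sourceTerm Ω T q₁ q₂ p) =
      damping Ω q₁ p' T * (f (flightStart Ω p') - f (flightStart Ω p)) +
      (damping Ω q₁ p' T - damping Ω q₁ p T) * f (flightStart Ω p) +
      (sourceTerm Ω T q₁ q₂ p' - sourceTerm Ω T q₁ q₂ p) := by ring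
  rw [e3]
  refine (abs_add_three _ _ _).trans ?_
  rw [abs_mul, abs_mul, abs_of_pos hw']
  gcongr

/-- Covers the borderline where `p` hits the boundary exactly at time 0 while nearby points reach
time 0 first: the start of the flight of `p` then has time 0 by continuity, so `f` equals `f₀` there
as well. -/
theorem tendsto_flightStart_initial (hp : p ∈ firstReboundRegular Ω T) :
    Tendsto (fun p' => f (flightStart Ω p'))
      (𝓝[firstReboundRegular Ω T ∩ {p' | ENNReal.ofReal p'.1 < exitTime Ω p'.2.1 p'.2.2}] p)
      (𝓝 (f (flightStart Ω p))) := by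
  set l := 𝓝[firstReboundRegular Ω T ∩
    {p' | ENNReal.ofReal p'.1 < exitTime Ω p'.2.1 p'.2.2}] p with hl
  rcases l.eq_or_neBot with hb | hb
  · rw [hb]; exact tendsto_bot
  have hle : l ≤ 𝓝[firstReboundRegular Ω T] p := nhdsWithin_mono _ inter_subset_left
  have hself : ∀ᶠ p' in l, p' ∈ firstReboundRegular Ω T ∧ (flightStart Ω p').1 = 0 := by
    filter_upwards [self_mem_nhdsWithin] with p' hp'
    refine ⟨hp'.1, ?_⟩
    rw [flightStart_of_lt hp'.1.1.1 hp'.2]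
  have hst := (H.domain.continuousOn_flightStart p hp).mono_left hle
  have h0 : (flightStart Ω p).1 = 0 := by
    refine tendsto_nhds_unique (hst.fst_nhds) (tendsto_const_nhds.congr' ?_)
    filter_upwards [hself] with p' hp' using hp'.2.symm
  have hinit : ∀ p' ∈ firstReboundRegular Ω T, (flightStart Ω p').1 = 0 →
      f (flightStart Ω p') = f₀ (flightStart Ω p').2 := fun p' hp' h => by
    have h1 := H.sol.initial _ _ (flightStart_mem hp').2
    rw [← h] at h1
    exact h1
  rw [hinit p hp h0]
  have h1 : Tendsto (fun p' => (flightStart Ω p').2) l (𝓝[phaseSet Ω] (flightStart Ω p).2) := by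
    refine tendsto_nhdsWithin_iff.2 ⟨hst.snd_nhds, ?_⟩
    filter_upwards [hself] with p' hp' using (flightStart_mem hp'.1).2
  refine (((H.continuousOn_initial _ (flightStart_mem hp).2).tendsto).comp h1).congr' ?_
  filter_upwards [hself] with p' hp'
  exact (hinit p' hp'.1 hp'.2).symm

theorem oscillation_of_flightStart {A : Set (ℝ × E3 × E3)} (hA : A ⊆ firstReboundRegular Ω T)
    (hp : p ∈ firstReboundRegular Ω T) {K η : ℝ} (hη : 0 ≤ η) (hK0 : 0 ≤ K)
    (hK : ∀ t ∈ Ioo 0 T, ∀ x ∈ Ω, ∀ v : E3, ‖v‖ ≤ ‖p.2.2‖ → |q₁ (t, x, v)| ≤ K)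
    (h : exitTime Ω p.2.1 p.2.2 ≤ ENNReal.ofReal p.1 → ∀ δ > 0,
      ∀ᶠ p' in 𝓝[A ∩ {p' | exitTime Ω p'.2.1 p'.2.2 ≤ ENNReal.ofReal p'.1}] p,
        |f (flightStart Ω p') - f (flightStart Ω p)| ≤ η + δ) :
    OscillationLE f A p (Real.exp (K * flightTime Ω p) * η) := by
  refine H.oscillation_transport hp (nhdsWithin_mono _ hA) hη hK0 hK fun δ hδ => ?_
  have hsplit : A = A ∩ {p' | exitTime Ω p'.2.1 p'.2.2 ≤ ENNReal.ofReal p'.1} ∪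
      A ∩ {p' | ENNReal.ofReal p'.1 < exitTime Ω p'.2.1 p'.2.2} := by
    rw [← inter_union_distrib_left]
    refine (inter_eq_left.2 fun q _ => ?_).symm
    exact le_or_gt (exitTime Ω q.2.1 q.2.2) (ENNReal.ofReal q.1)
  rw [hsplit, nhdsWithin_union, eventually_sup]
  constructor
  · rcases le_or_gt (exitTime Ω p.2.1 p.2.2) (ENNReal.ofReal p.1) with hE | hE
    · exact h hE δ hδ
    -- Without a rebound at `p` there is none nearby, so this piece is empty close to `p`.
    · filter_upwards [nhdsWithin_mono _ (inter_subset_left.trans hA)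
        (H.domain.eventually_time_lt_exitTime hp hE), self_mem_nhdsWithin] with p' h1 h2
      exact absurd h1 (not_lt.2 h2.2)
  · have h1 := (H.tendsto_flightStart_initial hp).mono_left
      (nhdsWithin_mono _ (inter_subset_inter_left _ hA))
    filter_upwards [Metric.tendsto_nhds.1 h1 δ hδ] with p' hp'
    rw [Real.dist_eq] at hp'
    linarith

theorem tendsto_boundary_flightStart {A : Set (ℝ × E3 × E3)}
    (hA : A ⊆ firstReboundRegular Ω T) (hp : p ∈ firstReboundRegular Ω T)
    (hE : exitTime Ω p.2.1 p.2.2 ≤ ENNReal.ofReal p.1) :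
    Tendsto (fun p' => g (flightStart Ω p'))
      (𝓝[A ∩ {p' | exitTime Ω p'.2.1 p'.2.2 ≤ ENNReal.ofReal p'.1}] p)
      (𝓝 (g (flightStart Ω p))) := by
  have hmem : ∀ p' ∈ firstReboundRegular Ω T,
      exitTime Ω p'.2.1 p'.2.2 ≤ ENNReal.ofReal p'.1 →
      flightStart Ω p' ∈ Icc 0 T ×ˢ boundaryContinuitySet Ω := fun p' hp' h => by
    refine ⟨(flightStart_mem hp').1, ?_⟩
    rw [flightStart_of_le h]
    exact hp'.2.2 h
  refine (H.continuousOn_boundary _ (hmem p hp hE)).tendsto.comp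
    (tendsto_nhdsWithin_iff.2 ⟨?_, ?_⟩)
  · exact (H.domain.continuousOn_flightStart p hp).mono_left
      (nhdsWithin_mono _ (inter_subset_left.trans hA))
  · filter_upwards [self_mem_nhdsWithin] with p' hp' using hmem p' (hA hp'.1) hp'.2

theorem flightStart_eq (hp : p ∈ firstReboundRegular Ω T)
    (hE : exitTime Ω p.2.1 p.2.2 ≤ ENNReal.ofReal p.1) :
    f (flightStart Ω p) = (1 - α) * f (timedBounce Ω p) + g (flightStart Ω p) := by
  have h1 := (flightStart_mem hp).1
  rw [flightStart_of_le hE] at h1 ⊢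
  exact H.sol.boundary _ h1 _ _ (hp.2.2 hE)

theorem oscillation_of_timedBounce (hp : p ∈ continuitySet Ω T)
    (hE : exitTime Ω p.2.1 p.2.2 ≤ ENNReal.ofReal p.1) {K η : ℝ} (hη : 0 ≤ η) (hK0 : 0 ≤ K)
    (hK : ∀ t ∈ Ioo 0 T, ∀ x ∈ Ω, ∀ v : E3, ‖v‖ ≤ ‖p.2.2‖ → |q₁ (t, x, v)| ≤ K)
    (h : OscillationLE f (continuitySet Ω T) (timedBounce Ω p) η) :
    OscillationLE f (continuitySet Ω T) p
      (Real.exp (K * flightTime Ω p) * ((1 - α) * η)) := by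
  have hα0 : 0 ≤ 1 - α := sub_nonneg.2 H.accommodation.2
  have hα1 : 1 - α ≤ 1 := by linarith [H.accommodation.1]
  have hp1 := H.domain.continuitySet_subset hp
  refine H.oscillation_of_flightStart H.domain.continuitySet_subset hp1
    (mul_nonneg hα0 hη) hK0 hK fun _ δ hδ => ?_
  filter_upwards [(H.domain.tendsto_timedBounce hp hE).eventually (h (δ / 2) (by positivity)),
    Metric.tendsto_nhds.1 (H.tendsto_boundary_flightStart H.domain.continuitySet_subset hp1 hE)
      (δ / 2) (by positivity), self_mem_nhdsWithin] with p' h1 h2 h3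
  rw [Real.dist_eq] at h2
  rw [H.flightStart_eq hp1 hE, H.flightStart_eq (H.domain.continuitySet_subset h3.1) h3.2]
  have e : (1 - α) * f (timedBounce Ω p') + g (flightStart Ω p') -
      ((1 - α) * f (timedBounce Ω p) + g (flightStart Ω p)) =
      (1 - α) * (f (timedBounce Ω p') - f (timedBounce Ω p)) +
      (g (flightStart Ω p') - g (flightStart Ω p)) := by ring
  rw [e]
  refine (abs_add_le _ _).trans ?_
  rw [abs_mul, abs_of_nonneg hα0]
  have h4 := mul_le_mul_of_nonneg_left h1 hα0
  have h5 : (1 - α) * (δ / 2) ≤ 1 * (δ / 2) := by gcongr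
  linarith

theorem oscillation_eq_zero_of_finite (N : ℕ) : ∀ p ∈ continuitySet Ω T,
    reboundTime Ω p.2 N ≤ ENNReal.ofReal p.1 →
    ENNReal.ofReal p.1 < reboundTime Ω p.2 (N + 1) →
    OscillationLE f (continuitySet Ω T) p 0 := by
  induction N with
  | zero =>
    intro p hp _ h
    rw [zero_add, reboundTime_one] at h
    obtain ⟨K, hK0, hK⟩ := H.bounded_fst ‖p.2.2‖
    have := H.oscillation_of_flightStart H.domain.continuitySet_subset
      (H.domain.continuitySet_subset hp) le_rfl hK0 hK fun hE => absurd h (not_lt.2 hE)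
    rwa [mul_zero] at this
  | succ N ih =>
    intro p hp h1 h2
    have hE : exitTime Ω p.2.1 p.2.2 ≤ ENNReal.ofReal p.1 := by
      refine le_trans ?_ h1
      rw [reboundTime_succ]
      exact le_self_add
    obtain ⟨K, hK0, hK⟩ := H.bounded_fst ‖p.2.2‖
    have h3 := ih (timedBounce Ω p) (H.domain.timedBounce_mem hp hE)
      ((reboundTime_succ_le_iff hE N).1 h1)
      (not_le.1 fun h => not_le.2 h2 ((reboundTime_succ_le_iff hE (N + 1)).2 h))
    have := H.oscillation_of_timedBounce hp hE le_rfl hK0 hK h3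
    rwa [mul_zero, mul_zero] at this

theorem continuousOn_of_inflow (hα : α = 1) : ContinuousOn f (firstReboundRegular Ω T) := by
  intro p hp
  obtain ⟨K, hK0, hK⟩ := H.bounded_fst ‖p.2.2‖
  refine OscillationLE.continuousWithinAt ?_
  have := H.oscillation_of_flightStart Subset.rfl hp le_rfl hK0 hK fun hE δ hδ => by
    filter_upwards [Metric.tendsto_nhds.1 (H.tendsto_boundary_flightStart Subset.rfl hp hE)
      δ hδ, self_mem_nhdsWithin] with p' h1 h2
    rw [Real.dist_eq] at h1
    rw [H.flightStart_eq hp hE, H.flightStart_eq h2.1 h2.2, hα]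
    simp only [sub_self, zero_mul, zero_add]
    exact h1.le
  rwa [mul_zero] at this

/-- Each rebound contributes a factor 1 - α, and the factors exp(K·flight time) telescope against
the remaining time. The bound B is taken at radius R + 1 because neighbouring points may be slightly
faster. -/
theorem oscillation_le_pow {B K R : ℝ} (hB0 : 0 ≤ B) (hK0 : 0 ≤ K)
    (hB : ∀ t ∈ Icc 0 T, ∀ p ∈ phaseSet Ω, ‖p.2‖ ≤ R + 1 → |f (t, p)| ≤ B)
    (hK : ∀ t ∈ Ioo 0 T, ∀ x ∈ Ω, ∀ v : E3, ‖v‖ ≤ R → |q₁ (t, x, v)| ≤ K) (M : ℕ) :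
    ∀ p ∈ continuitySet Ω T, ‖p.2.2‖ ≤ R → reboundTime Ω p.2 M ≤ ENNReal.ofReal p.1 →
    OscillationLE f (continuitySet Ω T) p
      ((1 - α) ^ M * (Real.exp (K * p.1) * (2 * B))) := by
  induction M with
  | zero =>
    intro p hp hv _ δ hδ
    filter_upwards [eventually_velocity_le p _, self_mem_nhdsWithin] with p' h1 h2
    have h3 := hB p'.1 h2.1 p'.2 h2.2.1 (by linarith)
    have h4 := hB p.1 hp.1 p.2 hp.2.1 (by linarith)
    have h5 : (1 : ℝ) ≤ Real.exp (K * p.1) := Real.one_le_exp (mul_nonneg hK0 hp.1.1)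
    have h6 : 1 * (2 * B) ≤ Real.exp (K * p.1) * (2 * B) := by gcongr
    have h7 := abs_sub (f p') (f p)
    rw [pow_zero, one_mul]
    linarith
  | succ M ih =>
    intro p hp hv hM
    have hα0 : 0 ≤ 1 - α := sub_nonneg.2 H.accommodation.2
    have hE : exitTime Ω p.2.1 p.2.2 ≤ ENNReal.ofReal p.1 := by
      refine le_trans ?_ hM
      rw [reboundTime_succ]
      exact le_self_add
    have hfr := fst_mem_frontier_of_mem_boundaryContinuitySet
      ((H.domain.continuitySet_subset hp).2.2 hE)
    have h3 := ih (timedBounce Ω p) (H.domain.timedBounce_mem hp hE)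
      ((H.domain.norm_reflect hfr _).trans_le hv) ((reboundTime_succ_le_iff hE M).1 hM)
    have h4 := H.oscillation_of_timedBounce hp hE (by positivity) hK0
      (fun t ht x hx v hv' => hK t ht x hx v (hv'.trans hv)) h3
    convert h4 using 1
    have e : Real.exp (K * p.1) =
        Real.exp (K * flightTime Ω p) * Real.exp (K * (timedBounce Ω p).1) := by
      rw [← Real.exp_add, timedBounce, flightTime_of_le hE]
      ring_nf
    rw [e, pow_succ]
    ring

theorem continuousOn_of_bounded (hB : ∀ R : ℝ, ∃ B, 0 ≤ B ∧ ∀ t ∈ Icc 0 T, ∀ p ∈ phaseSet Ω,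
    ‖p.2‖ ≤ R → |f (t, p)| ≤ B) : ContinuousOn f (continuitySet Ω T) := by
  intro p hp
  by_cases hfin : ∃ N, ENNReal.ofReal p.1 < reboundTime Ω p.2 N
  · classical
    have h1 := Nat.find_spec hfin
    have h2 := fun m => Nat.find_min (m := m) hfin
    -- The least index with t < T_N gives T_{N-1} ≤ t by minimality.
    rcases hN : Nat.find hfin with _ | N
    · rw [hN, reboundTime_zero] at h1
      exact absurd h1 not_lt_zero
    · rw [hN] at h1 h2
      exact (H.oscillation_eq_zero_of_finite N p hp (not_lt.1 (h2 N N.lt_succ_self))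
        h1).continuousWithinAt
  · push Not at hfin
    obtain ⟨B, hB0, hB⟩ := hB (‖p.2.2‖ + 1)
    obtain ⟨K, hK0, hK⟩ := H.bounded_fst ‖p.2.2‖
    refine OscillationLE.continuousWithinAt fun δ hδ => ?_
    have hlim : Tendsto (fun M : ℕ => (1 - α) ^ M * (Real.exp (K * p.1) * (2 * B)))
        atTop (𝓝 (0 * (Real.exp (K * p.1) * (2 * B)))) :=
      (tendsto_pow_atTop_nhds_zero_of_lt_one (sub_nonneg.2 H.accommodation.2)
        (by linarith [H.accommodation.1])).mul_const _
    rw [zero_mul] at hlim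
    obtain ⟨M, hM⟩ := (hlim.eventually (gt_mem_nhds (half_pos hδ))).exists
    filter_upwards [H.oscillation_le_pow hB0 hK0 hB hK M p hp le_rfl (hfin M) (δ / 2)
      (half_pos hδ)] with p' h
    linarith

end IsSolutionWithContinuousData

end Kinetic

/-! ### Bounds up to the boundary, and initial times at inflection points. -/

namespace Kinetic

variable {Ω : Set E3} {T α : ℝ} {q₁ q₂ g f : ℝ × E3 × E3 → ℝ} {f₀ : E3 × E3 → ℝ}

/-! ### Bounded solutions are bounded up to the boundary -/

theorem exists_Ioo_subset_of_exitTime_pos {x v : E3} (h : 0 < exitTime Ω x v) :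
    ∃ e > 0, ∀ s ∈ Ioo (0 : ℝ) e, x - s • v ∈ Ω := by
  obtain ⟨e, -, h0, h1⟩ := ENNReal.lt_iff_exists_real_btwn.1 h
  exact ⟨e, ENNReal.ofReal_pos.1 h0, fun s hs => sub_smul_mem_of_lt_exitTime hs.1
    (((ENNReal.ofReal_lt_ofReal_iff_of_nonneg hs.1.le).2 hs.2).trans h1)⟩

theorem IsBoundedC1Domain.exitTime_neg_pos (hΩ : IsBoundedC1Domain Ω) {p : E3 × E3}
    (h : p ∈ boundaryContinuitySet Ω) : 0 < exitTime Ω p.1 (-p.2) := by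
  rcases h with h | h
  · refine hΩ.exitTime_pos (p := (p.1, -p.2)) (Or.inr ⟨h.1, ?_⟩)
    have := h.2
    simpa using this
  · exact pos_iff_ne_zero.2 h.2.2.1

namespace IsSolution

variable {B R : ℝ} {x v : E3} {t : ℝ}

theorem abs_le_of_tendsto_back (hf : IsSolution Ω T α q₁ q₂ g f₀ f)
    (hB : ∀ t ∈ Icc 0 T, ∀ x ∈ Ω, ∀ v : E3, ‖v‖ ≤ R → |f (t, x, v)| ≤ B)
    (hv : ‖v‖ ≤ R) (ht : t ∈ Ioc 0 T) (hp : (x, v) ∈ phaseSet Ω) (hE : 0 < exitTime Ω x v) :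
    |f (t, x, v)| ≤ B := by
  obtain ⟨e, he, hs⟩ := exists_Ioo_subset_of_exitTime_pos hE
  have hev : ∀ᶠ s : ℝ in 𝓝[<] 0, t + s ∈ Icc 0 T ∧ x + s • v ∈ Ω := by
    have h1 : Ioo (-(min e t)) 0 ∈ 𝓝[<] (0 : ℝ) :=
      Ioo_mem_nhdsLT (neg_lt_zero.2 (lt_min he ht.1))
    filter_upwards [h1] with s hs'
    have h2 : -s < e ∧ -s < t := lt_min_iff.1 (by linarith [hs'.1])
    refine ⟨⟨by linarith, by linarith [hs'.2, ht.2]⟩, ?_⟩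
    have := hs (-s) ⟨by linarith [hs'.2], h2.1⟩
    rwa [neg_smul, sub_neg_eq_add] at this
  have htr := (hf.trace t (Ioc_subset_Icc_self ht) x v hp).tendsto.mono_left
    (le_inf (nhdsWithin_le_nhds (s := Iio 0)) (le_principal_iff.2 hev))
  simp only [add_zero, zero_smul] at htr
  refine le_of_tendsto htr.abs ?_
  filter_upwards [hev] with s hs using hB _ hs.1 _ hs.2 v hv

theorem abs_le_of_tendsto_forward (hf : IsSolution Ω T α q₁ q₂ g f₀ f)
    (hB : ∀ t ∈ Icc 0 T, ∀ x ∈ Ω, ∀ v : E3, ‖v‖ ≤ R → |f (t, x, v)| ≤ B)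
    (hv : ‖v‖ ≤ R) (ht : t ∈ Ico 0 T) (hp : (x, v) ∈ phaseSet Ω)
    (hE : 0 < exitTime Ω x (-v)) : |f (t, x, v)| ≤ B := by
  obtain ⟨e, he, hs⟩ := exists_Ioo_subset_of_exitTime_pos hE
  have hev : ∀ᶠ s : ℝ in 𝓝[>] 0, t + s ∈ Icc 0 T ∧ x + s • v ∈ Ω := by
    have h1 : Ioo 0 (min e (T - t)) ∈ 𝓝[>] (0 : ℝ) :=
      Ioo_mem_nhdsGT (lt_min he (sub_pos.2 ht.2))
    filter_upwards [h1] with s hs'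
    have h2 := lt_min_iff.1 hs'.2
    refine ⟨⟨by linarith [hs'.1, ht.1], by linarith⟩, ?_⟩
    have := hs s ⟨hs'.1, h2.1⟩
    rwa [smul_neg, sub_neg_eq_add] at this
  have htr := (hf.trace t (Ico_subset_Icc_self ht) x v hp).tendsto.mono_left
    (le_inf (nhdsWithin_le_nhds (s := Ioi 0)) (le_principal_iff.2 hev))
  simp only [add_zero, zero_smul] at htr
  refine le_of_tendsto htr.abs ?_
  filter_upwards [hev] with s hs using hB _ hs.1 _ hs.2 v hv

end IsSolution

namespace IsSolutionWithContinuousData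

variable (H : IsSolutionWithContinuousData Ω T α q₁ q₂ g f₀ f)
include H

/-- At t = 0 the backward characteristic leaves [0,T], and from an outgoing point the forward one
leaves Ω. Continuity of `f₀` along the spatial backward ray replaces the trace. -/
theorem abs_initial_le {B R : ℝ} {x v : E3} (hT : 0 < T)
    (hB : ∀ t ∈ Icc 0 T, ∀ x ∈ Ω, ∀ v : E3, ‖v‖ ≤ R → |f (t, x, v)| ≤ B)
    (hv : ‖v‖ ≤ R) (hp : (x, v) ∈ phaseSet Ω) (hE : 0 < exitTime Ω x v) :
    |f (0, x, v)| ≤ B := by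
  obtain ⟨e, he, hs⟩ := exists_Ioo_subset_of_exitTime_pos hE
  have hev : ∀ᶠ s : ℝ in 𝓝[>] 0, x - s • v ∈ Ω := by
    filter_upwards [Ioo_mem_nhdsGT he] with s hs' using hs s hs'
  have hphase : ∀ y ∈ Ω, (y, v) ∈ phaseSet Ω := fun y hy =>
    mem_phaseSet_iff.2 (Or.inl (Or.inl hy))
  have hc : Tendsto (fun s : ℝ => (x - s • v, v)) (𝓝[>] 0) (𝓝[phaseSet Ω] (x, v)) := by
    refine tendsto_nhdsWithin_iff.2 ⟨?_, ?_⟩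
    · have : Continuous fun s : ℝ => (x - s • v, v) := by fun_prop
      simpa using (this.tendsto 0).mono_left nhdsWithin_le_nhds
    · filter_upwards [hev] with s hs using hphase _ hs
  rw [H.sol.initial x v hp]
  refine le_of_tendsto ((H.continuousOn_initial _ hp).tendsto.comp hc).abs ?_
  filter_upwards [hev] with s hs
  have h := hB 0 ⟨le_rfl, hT.le⟩ _ hs v hv
  rwa [H.sol.initial _ _ (hphase _ hs)] at h

/-- Points of the boundary continuity set at t = T are reached by no characteristic inside [0,T] ×
Ω, so the trace says nothing there. They are bounded through the boundary condition, once `g` at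
time T is bounded as a limit from earlier times. -/
theorem bounded_on_phaseSet (hT : 0 < T) (hfb : BoundedOnVelocityBalls Ω (Icc 0 T) f) (R : ℝ) :
    ∃ B, 0 ≤ B ∧ ∀ t ∈ Icc 0 T, ∀ p ∈ phaseSet Ω, ‖p.2‖ ≤ R → |f (t, p)| ≤ B := by
  obtain ⟨B, hB0, hB⟩ := hfb R
  have hα := H.accommodation.1
  have hα0 : 0 ≤ 1 - α := sub_nonneg.2 H.accommodation.2
  have hα1 : 1 - α ≤ 1 := by linarith
  have hback : ∀ t ∈ Icc 0 T, ∀ p ∈ phaseSet Ω, 0 < exitTime Ω p.1 p.2 → ‖p.2‖ ≤ R →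
      |f (t, p)| ≤ B := by
    intro t ht p hp hE hv
    rcases ht.1.eq_or_lt with h0 | h0
    · rw [← h0]; exact H.abs_initial_le hT hB hv hp hE
    · exact H.sol.abs_le_of_tendsto_back hB hv ⟨h0, ht.2⟩ hp hE
  have hopen : ∀ t ∈ Ioo 0 T, ∀ p ∈ phaseSet Ω, ‖p.2‖ ≤ R → |f (t, p)| ≤ B := by
    intro t ht p hp hv
    rcases eq_or_ne (exitTime Ω p.1 p.2) 0 with h | h
    · exact H.sol.abs_le_of_tendsto_forward hB hv (Ioo_subset_Ico_self ht) hp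
        (H.domain.exitTime_neg_pos
          (H.domain.mem_boundaryContinuitySet_of_exitTime_eq_zero hp h))
    · exact hback t (Ioo_subset_Icc_self ht) p hp (pos_iff_ne_zero.2 h) hv
  have hgT : ∀ p ∈ boundaryContinuitySet Ω, ‖p.2‖ ≤ R → |g (T, p)| ≤ 2 * B := by
    intro p hp hv
    have hev : ∀ᶠ t : ℝ in 𝓝[<] T, t ∈ Ioo 0 T := Ioo_mem_nhdsLT hT
    have hc : Tendsto (fun t : ℝ => (t, p)) (𝓝[<] T)
        (𝓝[Icc 0 T ×ˢ boundaryContinuitySet Ω] (T, p)) := by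
      refine tendsto_nhdsWithin_iff.2 ⟨?_, ?_⟩
      · have : Continuous fun t : ℝ => (t, p) := by fun_prop
        exact (this.tendsto T).mono_left nhdsWithin_le_nhds
      · filter_upwards [hev] with t ht using ⟨Ioo_subset_Icc_self ht, hp⟩
    refine le_of_tendsto ((H.continuousOn_boundary (T, p)
      ⟨⟨hT.le, le_rfl⟩, hp⟩).tendsto.comp hc).abs ?_
    filter_upwards [hev] with t ht
    have h1 := H.sol.boundary t (Ioo_subset_Icc_self ht) p.1 p.2 hp
    have h2 := hopen t ht p (mem_phaseSet_of_mem_boundaryContinuitySet hp) hv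
    have h3 := hopen t ht (p.1, reflect Ω p.1 p.2) (H.domain.reflect_mem_phaseSet hp)
      ((H.domain.norm_reflect (fst_mem_frontier_of_mem_boundaryContinuitySet hp) _).trans_le hv)
    have h4 : g (t, p) = f (t, p) - (1 - α) * f (t, p.1, reflect Ω p.1 p.2) := by
      rw [show f (t, p) = _ from h1]; ring
    rw [Function.comp, h4]
    refine (abs_sub _ _).trans ?_
    rw [abs_mul, abs_of_nonneg hα0]
    have h5 : (1 - α) * |f (t, p.1, reflect Ω p.1 p.2)| ≤ 1 * B :=
      mul_le_mul hα1 h3 (abs_nonneg _) zero_le_one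
    linarith
  have hdiv : 0 ≤ 2 * B / α := by positivity
  refine ⟨3 * B + 2 * B / α, by positivity, fun t ht p hp hv => ?_⟩
  rcases mem_phaseSet_iff.1 hp with h | h
  · have := hback t ht p hp (H.domain.exitTime_pos h) hv
    linarith
  rcases ht.2.eq_or_lt with hT' | hT'
  · subst hT'
    have h1 := hgT p h hv
    have h2 : f (t, p) = _ := H.sol.boundary t ht p.1 p.2 h
    rcases h with hin | hin
    · have h3 := H.domain.reflect_mem_phaseSet (Or.inl hin)
      have h4 : 0 < exitTime Ω p.1 (reflect Ω p.1 p.2) := by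
        refine H.domain.exitTime_pos (p := (p.1, reflect Ω p.1 p.2)) (Or.inr ⟨hin.1, ?_⟩)
        have := hin.2
        rw [H.domain.inner_reflect hin.1]
        linarith
      have h5 := hback t ht _ h3 h4 ((H.domain.norm_reflect hin.1 _).trans_le hv)
      have h6 : (1 - α) * |f (t, p.1, reflect Ω p.1 p.2)| ≤ 1 * B :=
        mul_le_mul hα1 h5 (abs_nonneg _) zero_le_one
      rw [h2]
      refine (abs_add_le _ _).trans ?_
      rw [abs_mul, abs_of_nonneg hα0]
      change _ + |g (t, p)| ≤ _
      linarith
    -- Reflection is the identity here, so the boundary condition reads α·f = g; this is the source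
    -- of the term 2B/α.
    · rw [reflect_of_grazing hin.1.2] at h2
      have h3 : α * f (t, p) = g (t, p) := by
        have : f (t, p) = (1 - α) * f (t, p) + g (t, p) := h2
        linarith
      have h4 : |f (t, p)| ≤ 2 * B / α := by
        rw [← h3, abs_mul, abs_of_pos hα] at h1
        rwa [le_div_iff₀ hα, mul_comm]
      linarith
  · have := H.sol.abs_le_of_tendsto_forward hB hv ⟨ht.1, hT'⟩ hp (H.domain.exitTime_neg_pos h)
    change |f (t, p)| ≤ B at this
    linarith

end IsSolutionWithContinuousData

/-! ### Trajectories with many rebounds near an inflection point -/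

/-- A vector of prescribed length which is obtained from a nearly tangential one by adding a
vector from a thin cone around the normal is close to it. -/
theorem exists_cone_norm_sub_lt {v n : E3} (hn : ‖n‖ = 1) (hv : inner ℝ v n = 0) {ρ : ℝ}
    (hρ : 0 < ρ) : ∃ θ > 0, θ ≤ 1 ∧ ∃ κ > 0, κ ≤ 1 ∧ ∀ v' w : E3, ‖v' - v‖ < κ → ‖w‖ = ‖v'‖ →
      (1 - θ) * ‖w - v'‖ ≤ inner ℝ n (w - v') → ‖w - v‖ < ρ := by
  set μ := min 1 (ρ / (8 * (‖v‖ + 1))) with hμ_def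
  have hμ : 0 < μ := lt_min one_pos (by positivity)
  have hμ1 : μ ≤ 1 := min_le_left _ _
  have hμ2 : (‖v‖ + 1) * μ ≤ ρ / 8 := by
    calc (‖v‖ + 1) * μ ≤ (‖v‖ + 1) * (ρ / (8 * (‖v‖ + 1))) := by
          gcongr; exact min_le_right _ _
      _ = ρ / 8 := by field_simp
  refine ⟨μ ^ 2 / 2, by positivity, by nlinarith, min 1 (ρ / 8), lt_min one_pos (by positivity),
    min_le_left _ _, fun v' w hv' hw hcone => ?_⟩
  have hκ1 := lt_of_lt_of_le hv' (min_le_left _ _)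
  have hκ2 := lt_of_lt_of_le hv' (min_le_right _ _)
  set u := w - v' with hu
  have hwu : w = v' + u := by rw [hu]; abel
  -- Equal speeds turn the size of u into its component along v'. The cone makes u nearly ‖u‖·n, and
  -- v' is nearly orthogonal to n, so ‖u‖ is small.
  have hsq : ‖u‖ ^ 2 = -2 * inner ℝ v' u := by
    have h1 := norm_add_sq_real v' u
    rw [← hwu, hw] at h1
    linarith
  have hdev : ‖u - ‖u‖ • n‖ ≤ μ * ‖u‖ := by
    refine abs_le_of_sq_le_sq' ?_ (by positivity) |>.2
    rw [norm_sub_sq_real, norm_smul, norm_norm, hn, inner_smul_right, real_inner_comm]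
    nlinarith [norm_nonneg u]
  have hsplit : inner ℝ v' u = inner ℝ v' (u - ‖u‖ • n) + ‖u‖ * inner ℝ (v' - v) n := by
    rw [inner_sub_right v' u, inner_smul_right, inner_sub_left v' v, hv]
    ring
  have h1 : |inner ℝ v' (u - ‖u‖ • n)| ≤ ‖v'‖ * (μ * ‖u‖) :=
    (abs_real_inner_le_norm _ _).trans (by gcongr)
  have h2 : |inner ℝ (v' - v) n| ≤ ‖v' - v‖ := by
    simpa [hn] using abs_real_inner_le_norm (v' - v) n
  have hnv' : ‖v'‖ ≤ ‖v‖ + 1 := by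
    have := norm_le_norm_add_norm_sub' v' v
    linarith
  have hu_le : ‖u‖ ≤ ρ / 2 := by
    rcases (norm_nonneg u).eq_or_lt with h0 | h0
    · rw [← h0]; positivity
    have h3 : ‖u‖ * ‖u‖ ≤ ‖u‖ * (ρ / 2) := by
      have e1 := (abs_le.1 h1).1
      have e2 := mul_le_mul_of_nonneg_left ((neg_abs_le _).trans' (neg_le_neg h2)) h0.le
      have e3 : ‖v'‖ * (μ * ‖u‖) ≤ (‖v‖ + 1) * (μ * ‖u‖) := by gcongr
      have e4 := mul_le_mul_of_nonneg_right hμ2 h0.le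
      have e5 := mul_le_mul_of_nonneg_left hκ2.le h0.le
      nlinarith
    exact le_of_mul_le_mul_left h3 h0
  calc ‖w - v‖ = ‖u + (v' - v)‖ := by rw [hu]; congr 1; abel
    _ ≤ ‖u‖ + ‖v' - v‖ := norm_add_le _ _
    _ < ρ := by linarith

theorem inner_le_zero_of_mem_boundaryContinuitySet {p : E3 × E3}
    (h : p ∈ boundaryContinuitySet Ω) : inner ℝ (normal Ω p.1) p.2 ≤ 0 := by
  rcases h with h | h
  · exact h.2.le
  · exact h.1.2.le

/-- Reflections at points whose normal is close to `n` preserve cones around `n`. -/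
theorem IsBoundedC1Domain.reflect_mem_cone (hΩ : IsBoundedC1Domain Ω) {y w v' n : E3} {θ : ℝ}
    (hyw : (y, w) ∈ boundaryContinuitySet Ω) (hθ : θ ≤ 1)
    (hn : 1 - θ ≤ inner ℝ n (normal Ω y))
    (hcone : (1 - θ) * ‖w - v'‖ ≤ inner ℝ n (w - v')) :
    (1 - θ) * ‖reflect Ω y w - v'‖ ≤ inner ℝ n (reflect Ω y w - v') := by
  have hin := inner_le_zero_of_mem_boundaryContinuitySet hyw
  have hy := fst_mem_frontier_of_mem_boundaryContinuitySet hyw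
  rw [real_inner_comm] at hin
  set c := -(2 * inner ℝ w (normal Ω y)) with hc
  have hc0 : 0 ≤ c := by dsimp only at hin; linarith
  have e : reflect Ω y w - v' = (w - v') + c • normal Ω y := by
    rw [reflect, hc]; module
  have h1 : ‖(w - v') + c • normal Ω y‖ ≤ ‖w - v'‖ + c := by
    refine (norm_add_le _ _).trans (le_of_eq ?_)
    rw [norm_smul, hΩ.norm_normal hy, Real.norm_eq_abs, abs_of_nonneg hc0, mul_one]
  rw [e, inner_add_right, inner_smul_right]
  have h2 := mul_le_mul_of_nonneg_left h1 (sub_nonneg.2 hθ)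
  have h3 := mul_le_mul_of_nonneg_left hn hc0
  linarith

namespace IsSolutionWithContinuousData

variable (H : IsSolutionWithContinuousData Ω T α q₁ q₂ g f₀ f)
include H

/-- The final bound is independent of N because a rebound takes a convex combination of errors:
(1-α) times the error after it plus at most αε from `g`. The condition on ‖p.2.1 - x‖ + p.1·‖v'‖ is
a travel budget: a flight uses up as much time as it can add distance, so all footpoints stay within
r of `x`. -/
theorem abs_sub_le_of_near_inflection {x v v' n : E3} {a ε θ ρ r τ K L R : ℝ} (hθ : θ ≤ 1)
    (hε : 0 ≤ ε) (hK0 : 0 ≤ K) (hL0 : 0 ≤ L)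
    (hK : ∀ t ∈ Ioo 0 T, ∀ x ∈ Ω, ∀ v : E3, ‖v‖ ≤ R → |q₁ (t, x, v)| ≤ K)
    (hL : ∀ t ∈ Ioo 0 T, ∀ x ∈ Ω, ∀ v : E3, ‖v‖ ≤ R → |q₂ (t, x, v)| ≤ L)
    (hv' : ‖v'‖ ≤ R)
    (hclose : ∀ w : E3, ‖w‖ = ‖v'‖ → (1 - θ) * ‖w - v'‖ ≤ inner ℝ n (w - v') → ‖w - v‖ < ρ)
    (hnormal : ∀ y ∈ frontier Ω, ‖y - x‖ < r → 1 - θ ≤ inner ℝ n (normal Ω y))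
    (hinit : ∀ p ∈ phaseSet Ω, ‖p.1 - x‖ < r → ‖p.2 - v‖ < ρ → |f₀ p - a| ≤ ε)
    (hbdry : ∀ t ∈ Icc 0 T, t < τ → ∀ p ∈ boundaryContinuitySet Ω, ‖p.1 - x‖ < r →
      ‖p.2 - v‖ < ρ → |g (t, p) - α * a| ≤ α * ε) (N : ℕ) :
    ∀ p ∈ continuitySet Ω T, reboundTime Ω p.2 N ≤ ENNReal.ofReal p.1 →
      ENNReal.ofReal p.1 < reboundTime Ω p.2 (N + 1) → p.1 < τ → ‖p.2.2‖ = ‖v'‖ →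
      (1 - θ) * ‖p.2.2 - v'‖ ≤ inner ℝ n (p.2.2 - v') → ‖p.2.1 - x‖ + p.1 * ‖v'‖ < r →
      |f p - a| ≤ Real.exp (K * p.1) * (ε + (L + K * |a|) * p.1) := by
  have hC0 : 0 ≤ L + K * |a| := by positivity
  have hα0 : 0 ≤ 1 - α := sub_nonneg.2 H.accommodation.2
  induction N with
  | zero =>
    intro p hp _ hlt hτ hnorm hcone hr
    have hp1 := H.domain.continuitySet_subset hp
    rw [zero_add, reboundTime_one] at hlt
    have h1 := H.sol.abs_sub_le H.continuousOn_fst H.continuousOn_snd (c := a) hK0 hL0 hK hL hp1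
      (hnorm.trans_le hv')
    have hst := (flightStart_mem hp1).2
    rw [flightTime_of_lt hp.1.1 hlt] at h1
    rw [flightStart_of_lt hp.1.1 hlt] at h1 hst
    rw [H.sol.initial _ _ hst] at h1
    refine h1.trans ?_
    gcongr
    refine hinit _ hst ?_ (hclose _ hnorm hcone)
    calc ‖p.2.1 - p.1 • p.2.2 - x‖ = ‖(p.2.1 - x) - p.1 • p.2.2‖ := by congr 1; abel
      _ ≤ ‖p.2.1 - x‖ + ‖p.1 • p.2.2‖ := norm_sub_le _ _
      _ = ‖p.2.1 - x‖ + p.1 * ‖v'‖ := by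
        rw [norm_smul, Real.norm_eq_abs, abs_of_nonneg hp.1.1, hnorm]
      _ < r := hr
  | succ N ih =>
    intro p hp hle hlt hτ hnorm hcone hr
    have hp1 := H.domain.continuitySet_subset hp
    have hE : exitTime Ω p.2.1 p.2.2 ≤ ENNReal.ofReal p.1 := by
      refine le_trans ?_ hle
      rw [reboundTime_succ]
      exact le_self_add
    set e := (exitTime Ω p.2.1 p.2.2).toReal with he
    have he0 : 0 ≤ e := ENNReal.toReal_nonneg
    have hflight : flightTime Ω p = e := flightTime_of_le hE
    have hstart : flightStart Ω p = (p.1 - e, footpoint Ω p.2, p.2.2) := flightStart_of_le hE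
    have hfoot := hp1.2.2 hE
    have hfr := fst_mem_frontier_of_mem_boundaryContinuitySet hfoot
    have htime : p.1 - e ∈ Icc 0 T := by
      have := (flightStart_mem hp1).1
      rwa [hstart] at this
    have hdist : ‖footpoint Ω p.2 - x‖ + (p.1 - e) * ‖v'‖ < r := by
      have : ‖footpoint Ω p.2 - x‖ ≤ ‖p.2.1 - x‖ + e * ‖v'‖ := by
        calc ‖footpoint Ω p.2 - x‖ = ‖(p.2.1 - x) - e • p.2.2‖ := by
              rw [footpoint, ← he]; congr 1; abel
          _ ≤ ‖p.2.1 - x‖ + ‖e • p.2.2‖ := norm_sub_le _ _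
          _ = ‖p.2.1 - x‖ + e * ‖v'‖ := by
            rw [norm_smul, Real.norm_eq_abs, abs_of_nonneg he0, hnorm]
      linarith
    have hdist' : ‖footpoint Ω p.2 - x‖ < r := by
      have := mul_nonneg htime.1 (norm_nonneg v')
      linarith
    have hrec := ih (timedBounce Ω p) (H.domain.timedBounce_mem hp hE)
      ((reboundTime_succ_le_iff hE N).1 hle)
      (not_le.1 fun h => not_le.2 hlt ((reboundTime_succ_le_iff hE (N + 1)).2 h))
      (lt_of_le_of_lt (sub_le_self _ he0) hτ) ((H.domain.norm_reflect hfr _).trans hnorm)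
      (H.domain.reflect_mem_cone hfoot hθ (hnormal _ hfr hdist') hcone) hdist
    have hg := hbdry (p.1 - e) htime (by linarith) _ hfoot hdist' (hclose _ hnorm hcone)
    have h1 := H.sol.abs_sub_le H.continuousOn_fst H.continuousOn_snd (c := a) hK0 hL0 hK hL hp1
      (hnorm.trans_le hv')
    rw [H.flightStart_eq hp1 hE, hflight, hstart] at h1
    change |f (timedBounce Ω p) - a| ≤ Real.exp (K * (p.1 - e)) *
      (ε + (L + K * |a|) * (p.1 - e)) at hrec
    set Y := Real.exp (K * (p.1 - e)) * (ε + (L + K * |a|) * (p.1 - e)) with hY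
    have hexp : 1 ≤ Real.exp (K * (p.1 - e)) := Real.one_le_exp (mul_nonneg hK0 htime.1)
    have hYε : ε ≤ Y := by
      have h2 : 0 ≤ (L + K * |a|) * (p.1 - e) := mul_nonneg hC0 htime.1
      have h3 : 1 * (ε + (L + K * |a|) * (p.1 - e)) ≤ Y := by rw [hY]; gcongr
      linarith
    have hjump : |(1 - α) * f (timedBounce Ω p) + g (p.1 - e, footpoint Ω p.2, p.2.2) - a| ≤ Y := by
      have e1 : (1 - α) * f (timedBounce Ω p) + g (p.1 - e, footpoint Ω p.2, p.2.2) - a =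
          (1 - α) * (f (timedBounce Ω p) - a) +
          (g (p.1 - e, footpoint Ω p.2, p.2.2) - α * a) := by ring
      rw [e1]
      refine (abs_add_le _ _).trans ?_
      rw [abs_mul, abs_of_nonneg hα0]
      have h2 := mul_le_mul_of_nonneg_left hrec hα0
      have h3 := mul_le_mul_of_nonneg_left hYε H.accommodation.1.le
      linarith
    refine h1.trans ?_
    calc Real.exp (K * e) * (|(1 - α) * f (timedBounce Ω p) +
          g (p.1 - e, footpoint Ω p.2, p.2.2) - a| + (L + K * |a|) * e)
        ≤ Real.exp (K * e) * (Y + (L + K * |a|) * e) := by gcongr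
      _ ≤ Real.exp (K * e) * (Y + Real.exp (K * (p.1 - e)) * ((L + K * |a|) * e)) := by
        refine mul_le_mul_of_nonneg_left (add_le_add_right ?_ Y) (Real.exp_pos _).le
        exact le_mul_of_one_le_left (mul_nonneg hC0 he0) hexp
      _ = Real.exp (K * p.1) * (ε + (L + K * |a|) * p.1) := by
        have e2 : Real.exp (K * p.1) = Real.exp (K * e) * Real.exp (K * (p.1 - e)) := by
          rw [← Real.exp_add]; ring_nf
        rw [e2, hY]
        ring

theorem continuousWithinAt_of_inflection (hT : 0 < T) {x v : E3}
    (hp : (x, v) ∈ inwardInflection Ω) :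
    ContinuousWithinAt f {p | p ∈ continuitySet Ω T ∧
      (p.1 = 0 ∨ FinitelyManyRebounds Ω p.1 p.2)} (0, x, v) := by
  have hb : (x, v) ∈ boundaryContinuitySet Ω := Or.inr hp
  have hphase := mem_phaseSet_of_mem_boundaryContinuitySet hb
  have hα := H.accommodation.1
  have hx : x ∈ frontier Ω := hp.1.1
  set n := normal Ω x with hn_def
  have hn : ‖n‖ = 1 := H.domain.norm_normal hx
  have hvn : inner ℝ v n = 0 := by rw [real_inner_comm]; exact hp.1.2
  set a := f₀ (x, v) with ha
  -- Reflection fixes a grazing velocity, so compatibility becomes a = (1-α)a + g.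
  have hga : g (0, x, v) = α * a := by
    have h := H.compat x v hb
    rw [reflect_of_grazing hp.1.2, ← ha] at h
    linarith
  have hfa : f (0, x, v) = a := H.sol.initial x v hphase
  obtain ⟨K, hK0, hK⟩ := H.bounded_fst (‖v‖ + 1)
  obtain ⟨L, hL0, hL⟩ := H.bounded_snd (‖v‖ + 1)
  refine OscillationLE.continuousWithinAt fun δ hδ => ?_
  rw [hfa]
  obtain ⟨ρ₁, hρ₁, hf₁⟩ := Metric.continuousWithinAt_iff.1 (H.continuousOn_initial _ hphase)
    (δ / 2) (by positivity)
  obtain ⟨ρ₂, hρ₂, hg₂⟩ := Metric.continuousWithinAt_iff.1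
    (H.continuousOn_boundary (0, x, v) ⟨⟨le_rfl, hT.le⟩, hb⟩) (α * (δ / 2)) (by positivity)
  have hρ : 0 < min ρ₁ ρ₂ := lt_min hρ₁ hρ₂
  obtain ⟨θ, hθ0, hθ1, κ, hκ0, hκ1, hcone⟩ := exists_cone_norm_sub_lt hn hvn hρ
  have hnc : ContinuousWithinAt (fun y => inner ℝ n (normal Ω y)) (frontier Ω) x :=
    continuousWithinAt_const.inner (𝕜 := ℝ) (H.domain.continuousOn_normal x hx)
  obtain ⟨r₀, hr₀, hnr⟩ := Metric.continuousWithinAt_iff.1 hnc θ hθ0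
  set r := min r₀ (min ρ₁ ρ₂) with hr_def
  have hr : 0 < r := lt_min hr₀ hρ
  have hlim : Tendsto (fun p : ℝ × E3 × E3 =>
      Real.exp (K * p.1) * (δ / 2 + (L + K * |a|) * p.1)) (𝓝 (0, x, v)) (𝓝 (δ / 2)) := by
    have : Continuous fun p : ℝ × E3 × E3 =>
      Real.exp (K * p.1) * (δ / 2 + (L + K * |a|) * p.1) := by fun_prop
    simpa using this.tendsto (0, x, v)
  have hnear : ∀ᶠ p : ℝ × E3 × E3 in 𝓝 (0, x, v), ‖p.2.1 - x‖ + p.1 * ‖p.2.2‖ < r := by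
    have : Continuous fun p : ℝ × E3 × E3 => ‖p.2.1 - x‖ + p.1 * ‖p.2.2‖ := by fun_prop
    exact (this.tendsto (0, x, v)).eventually (gt_mem_nhds (by simpa using hr))
  have hvel : ∀ᶠ p : ℝ × E3 × E3 in 𝓝 (0, x, v), ‖p.2.2 - v‖ < κ := by
    have : Continuous fun p : ℝ × E3 × E3 => ‖p.2.2 - v‖ := by fun_prop
    exact (this.tendsto (0, x, v)).eventually (gt_mem_nhds (by simpa using hκ0))
  have htime : ∀ᶠ p : ℝ × E3 × E3 in 𝓝 (0, x, v), p.1 < ρ₂ :=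
    (continuous_fst.tendsto (0, x, v)).eventually (gt_mem_nhds hρ₂)
  have hinit : ∀ p ∈ phaseSet Ω, ‖p.1 - x‖ < r → ‖p.2 - v‖ < min ρ₁ ρ₂ →
      |f₀ p - a| ≤ δ / 2 := by
    intro p hp' h1 h2
    have h3 : dist p (x, v) < ρ₁ := by
      rw [Prod.dist_eq, dist_eq_norm, dist_eq_norm]
      exact max_lt (h1.trans_le ((min_le_right _ _).trans (min_le_left _ _)))
        (h2.trans_le (min_le_left _ _))
    exact (hf₁ hp' h3).le
  have hbdry : ∀ t ∈ Icc 0 T, t < ρ₂ → ∀ p ∈ boundaryContinuitySet Ω, ‖p.1 - x‖ < r →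
      ‖p.2 - v‖ < min ρ₁ ρ₂ → |g (t, p) - α * a| ≤ α * (δ / 2) := by
    intro t ht ht' p hp' h1 h2
    have h3 : dist (t, p) (0, x, v) < ρ₂ := by
      rw [Prod.dist_eq, Prod.dist_eq, dist_eq_norm, dist_eq_norm, dist_eq_norm, sub_zero,
        Real.norm_eq_abs, abs_of_nonneg ht.1]
      exact max_lt ht' (max_lt (h1.trans_le ((min_le_right _ _).trans (min_le_right _ _)))
        (h2.trans_le (min_le_right _ _)))
    have h4 := (hg₂ (show (t, p) ∈ Icc 0 T ×ˢ boundaryContinuitySet Ω from ⟨ht, hp'⟩) h3).le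
    rwa [hga] at h4
  have hnormal : ∀ y ∈ frontier Ω, ‖y - x‖ < r → 1 - θ ≤ inner ℝ n (normal Ω y) := by
    intro y hy h1
    have h2 := hnr hy (by rw [dist_eq_norm]; exact h1.trans_le (min_le_left _ _))
    rw [Real.dist_eq, ← hn_def, real_inner_self_eq_norm_sq, hn] at h2
    linarith [(abs_lt.1 h2).1]
  filter_upwards [nhdsWithin_le_nhds (hlim.eventually (gt_mem_nhds (half_lt_self hδ))),
    nhdsWithin_le_nhds hnear, nhdsWithin_le_nhds hvel, nhdsWithin_le_nhds htime,
    self_mem_nhdsWithin] with p h1 h2 h3 h4 h5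
  rw [zero_add]
  obtain ⟨hpC, h0 | ⟨N, hN1, hN2⟩⟩ := h5
  · have h6 : f p = f₀ p.2 := by
      have := H.sol.initial _ _ hpC.2.1
      rw [← h0] at this
      exact this
    have h7 : ‖p.2.1 - x‖ < r := by simpa [h0] using h2
    rw [h6]
    have h8 := hinit p.2 hpC.2.1 h7 (hcone p.2.2 p.2.2 h3 rfl (by simp))
    linarith
  · refine le_trans ?_ h1.le
    refine H.abs_sub_le_of_near_inflection hθ1 (by positivity) hK0 hL0 hK hL ?_
      (fun w => hcone p.2.2 w h3) hnormal hinit hbdry N p hpC hN1 hN2 h4 rfl (by simp) h2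
    have := norm_le_norm_add_norm_sub' p.2.2 v
    linarith

/-- At t = 0, interior and outgoing points have no rebound, and ingoing points exactly one, since
the reflected velocity is outgoing. Only inflection points need the cone argument. -/
theorem continuousOn_of_finite (hT : 0 < T) :
    ContinuousOn f {p | p ∈ continuitySet Ω T ∧
      (p.1 = 0 ∨ FinitelyManyRebounds Ω p.1 p.2)} := by
  rintro ⟨t, x, v⟩ ⟨hp, hfin⟩
  have hfinite : FinitelyManyRebounds Ω t (x, v) → ContinuousWithinAt f
      {p | p ∈ continuitySet Ω T ∧ (p.1 = 0 ∨ FinitelyManyRebounds Ω p.1 p.2)} (t, x, v) := by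
    rintro ⟨N, h1, h2⟩
    exact (H.oscillation_eq_zero_of_finite N _ hp h1 h2).continuousWithinAt.mono
      (sep_subset _ _)
  rcases hfin with h0 | hfin
  · change t = 0 at h0
    subst h0
    rcases mem_phaseSet_iff.1 hp.2.1 with h | h | h
    · refine hfinite ⟨0, by rw [reboundTime_zero]; exact zero_le, ?_⟩
      rw [zero_add, reboundTime_one, ENNReal.ofReal_zero]
      exact H.domain.exitTime_pos h
    · have hb : (x, v) ∈ boundaryContinuitySet Ω := Or.inl h
      have hE := H.domain.exitTime_eq_zero hb
      refine hfinite ⟨1, by rw [reboundTime_one, hE]; exact zero_le, ?_⟩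
      rw [reboundTime_succ, reboundTime_one, hE, zero_add, ENNReal.ofReal_zero]
      refine H.domain.exitTime_pos (Or.inr ?_)
      have h3 := h.2
      rw [bounce, H.domain.footpoint_eq hb]
      refine ⟨h.1, ?_⟩
      rw [H.domain.inner_reflect h.1]
      linarith
    · exact H.continuousWithinAt_of_inflection hT h
  · exact hfinite hfin

end IsSolutionWithContinuousData

end Kinetic

theorem lemma7p3 (Ω : Set E3) (hΩ : Kinetic.IsBoundedC1Domain Ω)
    (T : ℝ) (hT : 0 < T) (α : ℝ) (hα : α ∈ Ioc (0 : ℝ) 1)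
    (m : E3 → ℝ) (hm : Continuous m) (hm_pos : ∀ v, 0 < m v)
    (f₀ : E3 × E3 → ℝ) (hf₀ : ContinuousOn f₀ (Kinetic.phaseSet Ω))
    (g : ℝ × E3 × E3 → ℝ)
    (hg : ContinuousOn g (Icc 0 T ×ˢ Kinetic.boundaryContinuitySet Ω))
    (q₁ q₂ : ℝ × E3 × E3 → ℝ)
    (hq₁ : ContinuousOn q₁ (Ioo 0 T ×ˢ (Ω ×ˢ (univ : Set E3))))
    (hq₂ : ContinuousOn q₂ (Ioo 0 T ×ˢ (Ω ×ˢ (univ : Set E3))))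
    (hq₁_bdd : ∃ C : ℝ, ∀ t ∈ Ioo 0 T, ∀ x ∈ Ω, ∀ v : E3, |q₁ (t, x, v)| * m v ≤ C)
    (hq₂_bdd : ∃ C : ℝ, ∀ t ∈ Ioo 0 T, ∀ x ∈ Ω, ∀ v : E3, |q₂ (t, x, v)| * m v ≤ C)
    (hcompat : ∀ x v : E3, (x, v) ∈ Kinetic.boundaryContinuitySet Ω →
      f₀ (x, v) = (1 - α) * f₀ (x, Kinetic.reflect Ω x v) + g (0, x, v))
    (f : ℝ × E3 × E3 → ℝ) (hf : Kinetic.IsSolution Ω T α q₁ q₂ g f₀ f) :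
    ContinuousOn f
        {p | p ∈ Kinetic.continuitySet Ω T ∧
          (p.1 = 0 ∨ Kinetic.FinitelyManyRebounds Ω p.1 p.2)} ∧
      ((∃ C : ℝ, ∀ t ∈ Icc 0 T, ∀ x ∈ Ω, ∀ v : E3, |f (t, x, v)| * m v ≤ C) →
        ContinuousOn f (Kinetic.continuitySet Ω T)) ∧
      (α = 1 → ContinuousOn f
        (Kinetic.continuitySet Ω T ∪ Icc 0 T ×ˢ Kinetic.boundaryContinuitySet Ω)) := by
  have H : Kinetic.IsSolutionWithContinuousData Ω T α q₁ q₂ g f₀ f :=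
    ⟨hΩ, hα, hf₀, hg, hq₁, hq₂, Kinetic.boundedOnVelocityBalls_of_weight hm hm_pos hq₁_bdd,
      Kinetic.boundedOnVelocityBalls_of_weight hm hm_pos hq₂_bdd, hcompat, hf⟩
  refine ⟨H.continuousOn_of_finite hT, fun hfb => H.continuousOn_of_bounded fun R =>
    H.bounded_on_phaseSet hT (Kinetic.boundedOnVelocityBalls_of_weight hm hm_pos hfb) R,
    fun h1 => (H.continuousOn_of_inflow h1).mono ?_⟩
  exact union_subset hΩ.continuitySet_subset hΩ.boundary_subset
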